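/- Let $n\ge 0$ and let $\mathbb F_q$ be a finite field with $q$ elements. Let $\mathfrak{ut}_n(\mathbb F_q)$ be the Lie algebra of strictly upper triangular $n\times n$ matrices over $\mathbb F_q$ with matrix units $e_{i,j}$ ($i<j$), let $\mathrm{UT}_n(\mathbb F_q)$ be the group of upper triangular $n\times n$ matrices over $\mathbb F_q$ with ones on the diagonal, and let $\mathscr I_n(q)$ be the set of "closed" normal subgroups of $\mathrm{UT}_n(\mathbb F_q)$, i.e. those of the form $1+\mathfrak n$ with $\mathfrak n$ a Lie algebra ideal of $\mathfrak{ut}_n(\mathbb F_q)$. Definitions. Let $[[n]]=\{(i,j): 1\le i<j\le n\}$, ordered by $(i,j)\preceq(r,s)$ if $r\le i$ and $j\le s$. A set partition of $[n]$ is a subset of $[[n]]$ in which no two distinct edges share a left endpoint or share a right endpoint; it is nonnesting if it is an antichain for $\preceq$. For $\lambda\subseteq[[n]]$ and $\ell\ge0$ let $\lambda^{\uparrow\ell}$ be the set of $(r,s)\in[[n]]$ such that $(i,j)\preceq(r,s)$ and $s-r\ge j-i+\ell$ for some $(i,j)\in\lambda$. A tight splice is a disjoint union $S=\lambda\sqcup\nu$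 of a nonnesting set partition $\lambda$ and a set partition $\nu$ of $[n]$ such that (S1) for each $(i,k)\in\nu$ there is $j$ with $i<j<k$ and $(i,j)\in\lambda$ or $(j,k)\in\lambda$; (S2) for all $j<k$, there is $i$ with $(i,k)\in\nu$ and $(i,j)\in\lambda$ if and only if there is $l$ with $(k,l)\in\lambda$ and $(j,l)\in\nu$; and (T) $S\cap\lambda^{\uparrow2}=\emptyset$. A binding of $S$ is a quadruple $(i,j,k,l)$ with $(i,j),(k,l)\in\lambda$, $(i,k),(j,l)\in\nu$ and $j<k$. An $\mathbb F_q^\times$-labeling of $S$ is a function $\sigma$ from the set $\operatorname{bind}(S)$ of bindings to $\mathbb F_q^\times$. The columns of $S$ are the classes of the equivalence relation on $\lambda$ generated by $(i,j)\sim(k,l)$ for bindings $(i,j,k,l)$; the rows are the classes of the equivalence relation on $\nu$ generated by $(i,k)\sim(j,l)$ for bindings $(i,j,k,l)$; and $\operatorname{CR}(S)=\operatorname{cols}(S)\sqcup\operatorname{rows}(S)$. Fix, for each tight splice $S$, any total order on $\operatorname{CR}(S)$. An $\mathbb F_q^\times$-labeled loopless binary matroid on a totally ordered finite set $K$ is a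 pair $(M,\tau)$, where $M=(U,V,E)$ is a unidirectional bipartite graph (Stanley graph): $K=U\sqcup V$, $E\subseteq U\times V$, $u<v$ for all $(u,v)\in E$, every $v\in V$ lies on at least one edge; and $\tau:E\to\mathbb F_q^\times$ is a function. For a tuple $(S,\sigma,M,\tau)$, with $(S,\sigma)$ an $\mathbb F_q^\times$-labeled tight splice on $[n]$ and $(M,\tau)$ an $\mathbb F_q^\times$-labeled loopless binary matroid on $\operatorname{CR}(S)$, let $\mathfrak D_{S,\sigma}$ be the span of all $e_{r,s}$ with $(r,s)\in\lambda^{\uparrow0}\setminus S$ and all $e_{i,k}-\sigma(i,j,k,l)\,e_{j,l}$ with $(i,j,k,l)\in\operatorname{bind}(S)$. For a row $R$ let $b_R=e_{i,j}$ with $(i,j)\in R$, $i$ minimal; for a column $C$ let $$b_C=\sum_{(i,j)\in C}\Big(\prod\sigma(r,s,k,t)\Big)e_{i,j},$$ the product being over the bindings $(r,s,k,t)$ with $(r,s),(k,t)\in C$ and $k\le i$. Let $\mathfrak n_{S,\sigma,M,\tau}$ be the sum of $\mathfrak D_{S,\sigma}$ and the span of the elements $b_u+\sum_{(u,v)\in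 E}\tau(u,v)b_v$, for those $u\in U$ which are columns or are the start of at least one edge. Theorem. The map $(S,\sigma,M,\tau)\mapsto\mathfrak n_{S,\sigma,M,\tau}$ is a bijection from the set of all such tuples onto the set of Lie algebra ideals of $\mathfrak{ut}_n(\mathbb F_q)$. The map $\mathfrak n\mapsto1+\mathfrak n$ is a bijection from the set of Lie algebra ideals of $\mathfrak{ut}_n(\mathbb F_q)$ onto $\mathscr I_n(q)$ (in particular each $1+\mathfrak n$ is a normal subgroup). If $q$ is prime, then $\mathscr I_n(q)$ is the set of all normal subgroups of $\mathrm{UT}_n(\mathbb F_q)$. -/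

import Mathlib

attribute [local instance 100] LieRing.ofAssociativeRing

noncomputable section

/-! ### Edges, orders, nonnesting set partitions -/

/-- The set `[[n]]` of increasing edges `(i, j)`, `i < j`, on the vertex set `Fin n`. -/
def incEdges (n : ℕ) : Set (Fin n × Fin n) := {e | e.1 < e.2}

/-- `(i, j) ⪯_L (r, s)` if `r ≤ i` and `j = s`. -/
def leL {n : ℕ} (e f : Fin n × Fin n) : Prop := f.1 ≤ e.1 ∧ e.2 = f.2

/-- `(i, j) ⪯_R (r, s)` if `i = r` and `j ≤ s`. -/
def leR {n : ℕ} (e f : Fin n × Fin n) : Prop := e.1 = f.1 ∧ e.2 ≤ f.2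

/-- `(i, j) ⪯ (r, s)` if `r ≤ i` and `j ≤ s`. -/
def leE {n : ℕ} (e f : Fin n × Fin n) : Prop := f.1 ≤ e.1 ∧ e.2 ≤ f.2

/-- The height `j - i` of an increasing edge `(i, j)`. -/
def edgeHt {n : ℕ} (e : Fin n × Fin n) : ℕ := (e.2 : ℕ) - (e.1 : ℕ)

/-- Set partitions of `[n]`, as sets of increasing edges that are antichains for `⪯_L` and `⪯_R`. -/
structure IsSetPartition {n : ℕ} (S : Set (Fin n × Fin n)) : Prop where
  increasing : S ⊆ incEdges n
  antichainL : IsAntichain leL S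
  antichainR : IsAntichain leR S

/-- Nonnesting set partitions: set partitions which are antichains for `⪯`. -/
structure IsNonnesting {n : ℕ} (S : Set (Fin n × Fin n)) : Prop extends IsSetPartition S where
  antichain : IsAntichain leE S

/-- The upper set of increasing edges lying above some edge of `S` with height larger by at
least `l`. -/
def upSet {n : ℕ} (S : Set (Fin n × Fin n)) (l : ℕ) : Set (Fin n × Fin n) :=
  {f | f ∈ incEdges n ∧ ∃ e ∈ S, leE e f ∧ edgeHt e + l ≤ edgeHt f}

/-! ### Tight splices -/

/-- A tight splice `lam ⊔ nu` of a nonnesting set partition `lam`, with vertical edges `nu`. -/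
@[ext]
structure TightSplice (n : ℕ) where
  /-- the underlying nonnesting set partition -/
  lam : Set (Fin n × Fin n)
  /-- the vertical edges -/
  nu : Set (Fin n × Fin n)
  lam_nonnesting : IsNonnesting lam
  nu_setPartition : IsSetPartition nu
  disjoint : Disjoint lam nu
  splice_one : ∀ i k, (i, k) ∈ nu → ∃ j, i < j ∧ j < k ∧ ((i, j) ∈ lam ∨ (j, k) ∈ lam)
  splice_two : ∀ j k, j < k →
    ((∃ i, (i, k) ∈ nu ∧ (i, j) ∈ lam) ↔ (∃ l, (k, l) ∈ lam ∧ (j, l) ∈ nu))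
  tight : (lam ∪ nu) ∩ upSet lam 2 = ∅

namespace TightSplice

variable {n : ℕ} (S : TightSplice n)

/-- The bindings of a splice: quadruples `(i, j, k, l)` with horizontal edges `(i, j)`, `(k, l)`,
vertical edges `(i, k)`, `(j, l)`, and `j < k`. -/
def bind : Set (Fin n × Fin n × Fin n × Fin n) :=
  {b | (b.1, b.2.1) ∈ S.lam ∧ (b.2.2.1, b.2.2.2) ∈ S.lam ∧
    (b.1, b.2.2.1) ∈ S.nu ∧ (b.2.1, b.2.2.2) ∈ S.nu ∧ b.2.1 < b.2.2.1}

/-- The relation generating `∼_cols`: the two horizontal edges of a binding. -/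
def colStep (e f : Fin n × Fin n) : Prop := (e.1, e.2, f.1, f.2) ∈ S.bind

/-- The relation generating `∼_rows`: the two vertical edges of a binding. -/
def rowStep (e f : Fin n × Fin n) : Prop := (e.1, f.1, e.2, f.2) ∈ S.bind

/-- The columns: equivalence classes of horizontal edges under `∼_cols`. -/
def cols : Set (Set (Fin n × Fin n)) :=
  {C | ∃ e ∈ S.lam, C = {f | f ∈ S.lam ∧ Relation.EqvGen S.colStep e f}}

/-- The rows: equivalence classes of vertical edges under `∼_rows`. -/
def rows : Set (Set (Fin n × Fin n)) :=
  {R | ∃ e ∈ S.nu, R = {f | f ∈ S.nu ∧ Relation.EqvGen S.rowStep e f}}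

/-- The set of columns and rows, `cols ⊔ rows`. -/
abbrev CR : Type := S.cols ⊕ S.rows

end TightSplice

/-! ### Labeled loopless binary matroids -/

/-- An `Fˣ`-labeled loopless binary matroid on a totally ordered set `K`, in its graph model: a
bipartite graph `(U, V, E)` with `U ⊔ V = K`, all edges directed from `U` to `V` and from smaller
to larger elements, each vertex in `V` having at least one incoming edge, together with a labeling
of the edges by nonzero scalars. -/
structure LabeledMatroid (K : Type) [LinearOrder K] (F : Type*) [Field F] where
  U : Set K
  V : Set K
  isCompl : IsCompl U V
  E : Set (K × K)
  unidirectional : E ⊆ U ×ˢ V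
  covered : ∀ v ∈ V, ∃ u, (u, v) ∈ E
  increasing : ∀ u v, (u, v) ∈ E → u < v
  label : E → Fˣ

/-- The tuples `(S, σ, M, τ)`: a tight splice `S` of a nonnesting set partition of `[n]`, a labeling
`σ` of its bindings by nonzero scalars, and a labeled loopless binary matroid `(M, τ)` on its
columns and rows, which are totally ordered by `ord S`. -/
structure IdealDatum {n : ℕ} (ord : ∀ S : TightSplice n, LinearOrder S.CR)
    (F : Type*) [Field F] where
  S : TightSplice n
  sig : S.bind → Fˣ
  M : @LabeledMatroid S.CR (ord S) F _

/-! ### The Lie algebra and the group -/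

/-- The Lie algebra `ut_n(F)` of strictly upper triangular matrices. -/
def ut (n : ℕ) (F : Type*) [Field F] : LieSubalgebra F (Matrix (Fin n) (Fin n) F) where
  carrier := {a | ∀ i j, j ≤ i → a i j = 0}
  zero_mem' := by intro i j _; rfl
  add_mem' := by
    intro a b ha hb i j h
    simp [ha i j h, hb i j h]
  smul_mem' := by
    intro c a ha i j h
    simp [ha i j h]
  lie_mem' := by
    have key : ∀ a b : Matrix (Fin n) (Fin n) F, (∀ i j, j ≤ i → a i j = 0) →
        (∀ i j, j ≤ i → b i j = 0) → ∀ i j, j ≤ i → (a * b) i j = 0 := by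
      intro a b ha hb i j h
      rw [Matrix.mul_apply]
      refine Finset.sum_eq_zero fun k _ => ?_
      rcases le_total k i with hk | hk
      · rw [ha i k hk, zero_mul]
      · rw [hb k j (h.trans hk), mul_zero]
    intro a b ha hb i j h
    rw [Ring.lie_def, Matrix.sub_apply, key a b ha hb i j h, key b a hb ha i j h, sub_zero]

/-- The group `UT_n(F)` of upper triangular matrices with ones on the diagonal. -/
def UT (n : ℕ) (F : Type*) [Field F] : Subgroup (GL (Fin n) F) where
  carrier := {g | (∀ i j, j < i → (g : Matrix (Fin n) (Fin n) F) i j = 0) ∧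
    ∀ i, (g : Matrix (Fin n) (Fin n) F) i i = 1}
  one_mem' := by
    refine ⟨fun i j h => ?_, fun i => ?_⟩
    · simp [Matrix.one_apply_ne h.ne']
    · simp
  mul_mem' := by
    rintro a b ⟨ha, ha'⟩ ⟨hb, hb'⟩
    refine ⟨fun i j h => ?_, fun i => ?_⟩
    · rw [Units.val_mul, Matrix.mul_apply]
      refine Finset.sum_eq_zero fun k _ => ?_
      rcases lt_or_ge k i with hk | hk
      · rw [ha i k hk, zero_mul]
      · rw [hb k j (h.trans_le hk), mul_zero]
    · rw [Units.val_mul, Matrix.mul_apply, Finset.sum_eq_single i, ha', hb', one_mul]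
      · intro k _ hk
        rcases lt_or_gt_of_ne hk with h | h
        · rw [ha i k h, zero_mul]
        · rw [hb k i h, mul_zero]
      · simp
  inv_mem' := by
    rintro g ⟨hg, hg'⟩
    have : Invertible (g : Matrix (Fin n) (Fin n) F) := g.invertible
    have ht : ((g : Matrix (Fin n) (Fin n) F)⁻¹).BlockTriangular id :=
      Matrix.blockTriangular_inv_of_blockTriangular (M := (g : Matrix (Fin n) (Fin n) F))
        (b := id) (fun i j h => hg i j h)
    rw [← Matrix.coe_units_inv] at ht
    refine ⟨fun i j h => ht h, fun i => ?_⟩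
    have h1 : ((g : Matrix (Fin n) (Fin n) F) * (g⁻¹ : GL (Fin n) F)) i i = 1 := by
      rw [← Units.val_mul, mul_inv_cancel, Units.val_one, Matrix.one_apply_eq]
    rw [Matrix.mul_apply, Finset.sum_eq_single i, hg', one_mul] at h1
    · exact h1
    · intro k _ hk
      rcases lt_or_gt_of_ne hk with h | h
      · rw [hg i k h, zero_mul]
      · rw [ht h, mul_zero]
    · simp

/-- The subset `1 + I` of `UT_n(F)`. -/
def onePlus {n : ℕ} {F : Type*} [Field F] (I : LieIdeal F (ut n F)) : Set (UT n F) :=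
  {g | ∃ a ∈ I, ((g : GL (Fin n) F) : Matrix (Fin n) (Fin n) F) = 1 + (a : Matrix (Fin n) (Fin n) F)}

/-- The set of closed normal subgroups of `UT_n(F)`: normal subgroups of the form `1 + I` for a Lie
algebra ideal `I`. -/
def closedNormalSubgroups (n : ℕ) (F : Type*) [Field F] : Set (Subgroup (UT n F)) :=
  {N | N.Normal ∧ ∃ I : LieIdeal F (ut n F), (N : Set (UT n F)) = onePlus I}

/-! ### The ideal attached to a tuple -/

/-- The strictly upper triangular matrix whose entry at each increasing edge `e` is `f e`. -/
def utMk {n : ℕ} {F : Type*} [Field F] (f : Fin n × Fin n → F) : ut n F :=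
  ⟨Matrix.of fun i j => if i < j then f (i, j) else 0, fun _ _ h => if_neg h.not_gt⟩

/-- The matrix unit `e_{i,j}` of an increasing edge `(i, j)`. -/
def utE {n : ℕ} (F : Type*) [Field F] (e : Fin n × Fin n) : ut n F := utMk (Pi.single e 1)

namespace IdealDatum

variable {n : ℕ} {ord : ∀ S : TightSplice n, LinearOrder S.CR} {F : Type*} [Field F]
  (t : IdealDatum ord F)

/-- The subspace `D_{S,σ}`, spanned by the matrix units of all edges of `↑lam` outside the splice and
by the elements `e_{i,k} - σ(b) e_{j,l}` for the bindings `b = (i, j, k, l)`. -/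
def D : Submodule F (ut n F) :=
  Submodule.span F (utE F '' (upSet t.S.lam 0 \ (t.S.lam ∪ t.S.nu))) ⊔
    Submodule.span F (Set.range fun b : t.S.bind =>
      utE F (b.1.1, b.1.2.2.1) - (t.sig b : F) • utE F (b.1.2.1, b.1.2.2.2))

open Classical in
/-- The element `b_C` of a column `C`: its entry at an edge `(i, j)` of `C` is the product of the
labels of the bindings between edges of `C` lying above `(i, j)`; other entries are zero. -/
def bCol (C : Set (Fin n × Fin n)) : ut n F :=
  utMk fun e => if e ∈ C then
    ∏ b : t.S.bind, (if (b.1.1, b.1.2.1) ∈ C ∧ (b.1.2.2.1, b.1.2.2.2) ∈ C ∧ b.1.2.2.1 ≤ e.1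
      then (t.sig b : F) else 1) else 0

open Classical in
/-- The element `b_R` of a row `R`: the matrix unit of the edge `(i, j)` of `R` with `i` minimal. -/
def bRow (R : Set (Fin n × Fin n)) : ut n F :=
  utMk fun e => if e ∈ R ∧ ∀ f ∈ R, e.1 ≤ f.1 then 1 else 0

/-- The element `b_x` of a column or row `x`. -/
def bVec : t.S.CR → ut n F :=
  Sum.elim (fun C => t.bCol C.1) (fun R => bRow R.1)

open Classical in
/-- The element `b_u + ∑ τ(u, v) b_v`, summed over all edges `(u, v)` of the matroid's graph which
start at `u`. -/
def gen (u : t.S.CR) : ut n F :=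
  t.bVec u + ∑ v : t.S.CR, if h : (u, v) ∈ t.M.E then (t.M.label ⟨(u, v), h⟩ : F) • t.bVec v else 0

/-- The subspace `n_{S,σ,M,τ}`: it is spanned by `D_{S,σ}` and by the elements `gen u` for those
`u ∈ U` which are columns or the start of some edge. -/
def toSubspace : Submodule F (ut n F) :=
  Submodule.span F (t.gen '' {u | u ∈ t.M.U ∧ ((∃ v, (u, v) ∈ t.M.E) ∨ u.isLeft = true)}) ⊔ t.D

end IdealDatum

end

/-! Fix a labeled tight splice `(S, σ)` with horizontal part `λ`. Two subspaces depend on it alone: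
`D`, and `hull`, the matrices supported above `λ` whose entries along each binding have ratio `σ`.
Modulo the matrix units of `upSet λ 2`, the bracket of `x` in `hull` with `e_{j,k}` is `x_{ij}
e_{ik} - x_{kl} e_{jl}`, where `(i,j)` and `(k,l)` are the edges of `λ` ending at `j` and starting
at `k` (a term is absent if its edge is). Condition (S2) and the ratios `σ` put this in `D`
(`lie_mem_D`), so every subspace between `D` and `hull` is an ideal. The `b_x` give a basis of `hull
/ D` (`comb_mem_D_iff`, `hull_le`).

Ideals of type `(S, σ)` are therefore subspaces of the coordinate space on `CR`, subject to two
conditions: no column coordinate vanishes identically, and no row basis vector is contained. These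
conditions make `S` recoverable: `λ` consists of the minimal edges of the support, `ν` of the edges
above `λ` and off `λ` whose matrix unit is missing. Reduced echelon form turns such subspaces into
labeled matroids: leading indices are the pivots, and `V` consists of the other coordinates that are
not identically zero. The two conditions also settle what an isolated vertex of `U` means: a basis
vector for a column, a zero coordinate for a row.

Conversely, given an ideal `I`, let `λ` be the minimal edges of its support. The main point is that
`I` contains every matrix unit of `upSet λ 2`, by iterated brackets and an induction from the top.
The bracket formula then yields (S2) and the labels, and `D ≤ I ≤ hull`.

For groups, `(1+x)(1+y) = 1+x+y+xy`, and a commutator is `1 + [x,a] + [x,a]v`. The corrections `xy`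
and `[x,a]v` are supported in `prodSet`, that is, on `upSet λ 2` and the compositions of two edges
of `λ`. `IsCommClosed` records what ideals and the sets `N - 1` (over a prime field) have in common,
and `utSupp_prodSet_subset` shows that it already forces everything supported in `prodSet` to belong
to the set. So the corrections can be added or removed at will, which translates ideals and normal
subgroups into each other. -/

noncomputable section

/-! ### Reduced row echelon forms and labeled matroids -/

section RowEchelon

variable {K : Type} [LinearOrder K] [Fintype K] {F : Type*} [Field F]

/-- The rows `r u`, for `u` in the set `p` of pivots, are in reduced echelon form. -/
structure IsReducedEchelon (p : Set K) (r : K → K → F) : Prop where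
  diag : ∀ u ∈ p, r u u = 1
  off : ∀ u ∈ p, ∀ v ∈ p, v ≠ u → r u v = 0
  lead : ∀ u ∈ p, ∀ v < u, r u v = 0

/-- The set of leading indices of the vectors of a subspace. -/
def leadSet (P : Submodule F (K → F)) : Set K :=
  {u | ∃ x ∈ P, x u ≠ 0 ∧ ∀ v < u, x v = 0}

open Classical in
-- Row `u` is the only row that is nonzero at the pivot `u`, so the coefficients of a combination
-- can be read off at the pivots.
lemma IsReducedEchelon.expand {p : Set K} {r : K → K → F} (h : IsReducedEchelon p r)
    {x : K → F} (hx : x ∈ Submodule.span F (r '' p)) :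
    x = ∑ u, if u ∈ p then x u • r u else 0 := by
  induction hx using Submodule.span_induction with
  | mem y hy =>
    obtain ⟨u, hu, rfl⟩ := hy
    rw [Finset.sum_eq_single u]
    · simp [hu, h.diag u hu]
    · intro v _ hv
      by_cases hvp : v ∈ p
      · simp [hvp, h.off u hu v hvp hv]
      · simp [hvp]
    · simp
  | zero => simp
  | add y z _ _ hy hz =>
    conv_lhs => rw [hy, hz]
    rw [← Finset.sum_add_distrib]
    refine Finset.sum_congr rfl fun u _ => ?_
    split_ifs <;> simp [add_smul]
  | smul c y _ hy =>
    conv_lhs => rw [hy]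
    rw [Finset.smul_sum]
    refine Finset.sum_congr rfl fun u _ => ?_
    split_ifs <;> simp [mul_smul]

lemma IsReducedEchelon.leadSet_span {p : Set K} {r : K → K → F} (h : IsReducedEchelon p r) :
    leadSet (Submodule.span F (r '' p)) = p := by
  classical
  ext u
  constructor
  · rintro ⟨x, hx, hxu, hlt⟩
    by_contra hu
    apply hxu
    rw [h.expand hx, Finset.sum_apply]
    refine Finset.sum_eq_zero fun v _ => ?_
    split_ifs with hv
    · rcases lt_trichotomy v u with h1 | h1 | h1
      · simp [hlt v h1]
      · exact absurd (h1 ▸ hv) hu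
      · simp [h.lead v hv u h1]
    · rfl
  · intro hu
    exact ⟨r u, Submodule.subset_span ⟨u, hu, rfl⟩, by simp [h.diag u hu], h.lead u hu⟩

lemma IsReducedEchelon.row_unique {p : Set K} {r r' : K → K → F} (h : IsReducedEchelon p r)
    (h' : IsReducedEchelon p r')
    (hs : Submodule.span F (r '' p) = Submodule.span F (r' '' p)) {u : K} (hu : u ∈ p) :
    r u = r' u := by
  classical
  have h1 : r u - r' u ∈ Submodule.span F (r '' p) :=
    sub_mem (Submodule.subset_span ⟨u, hu, rfl⟩) (hs ▸ Submodule.subset_span ⟨u, hu, rfl⟩)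
  rw [← sub_eq_zero, h.expand h1]
  refine Finset.sum_eq_zero fun v _ => ?_
  split_ifs with hv
  · by_cases hvu : v = u
    · subst hvu; simp [h.diag v hv, h'.diag v hv]
    · simp [h.off u hu v hv hvu, h'.off u hu v hv hvu]
  · rfl

lemma exists_reduced_row (P : Submodule F (K → F)) (u : K) (hu : u ∈ leadSet P) :
    ∃ x ∈ P, x u = 1 ∧ (∀ v ∈ leadSet P, v ≠ u → x v = 0) ∧ ∀ v < u, x v = 0 := by
  classical
  -- Downward induction: reduced rows with larger leading index vanish at and before `u`, so they
  -- can clear the later pivot entries of `x` without disturbing its leading one.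
  induction u using WellFoundedGT.induction with
  | ind u ih =>
    obtain ⟨x, hx, hxu, hlt⟩ := hu
    have ih' : ∀ v, ∃ y ∈ P, u < v → v ∈ leadSet P →
        y v = 1 ∧ (∀ w ∈ leadSet P, w ≠ v → y w = 0) ∧ ∀ w < v, y w = 0 := by
      intro v
      by_cases hv : u < v ∧ v ∈ leadSet P
      · obtain ⟨y, hy, hy'⟩ := ih v hv.1 hv.2
        exact ⟨y, hy, fun _ _ => hy'⟩
      · exact ⟨0, zero_mem _, fun h1 h2 => absurd ⟨h1, h2⟩ hv⟩
    choose r hrP hr using ih'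
    let s : K → F := ∑ v, if u < v ∧ v ∈ leadSet P then x v • r v else 0
    have hs : s ∈ P := by
      refine Submodule.sum_mem _ fun v _ => ?_
      split_ifs
      · exact P.smul_mem _ (hrP v)
      · exact zero_mem _
    have hsle : ∀ w ≤ u, s w = 0 := by
      intro w hw
      simp only [s, Finset.sum_apply]
      refine Finset.sum_eq_zero fun v _ => ?_
      split_ifs with hv
      · simp [(hr v hv.1 hv.2).2.2 w (hw.trans_lt hv.1)]
      · rfl
    have hsgt : ∀ w ∈ leadSet P, u < w → s w = x w := by
      intro w hw huw
      simp only [s, Finset.sum_apply]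
      rw [Finset.sum_eq_single w]
      · simp [hw, huw, (hr w huw hw).1]
      · intro v _ hv
        split_ifs with hv'
        · simp [(hr v hv'.1 hv'.2).2.1 w hw hv.symm]
        · rfl
      · simp
    refine ⟨(x u)⁻¹ • (x - s), P.smul_mem _ (sub_mem hx hs), ?_, ?_, ?_⟩
    · simp [hsle u le_rfl, hxu]
    · intro v hv hvu
      rcases lt_or_gt_of_ne hvu with h | h
      · simp [hsle v h.le, hlt v h]
      · simp [hsgt v hv h]
    · intro v hv
      simp [hsle v hv.le, hlt v hv]

/-- Every subspace has a basis in reduced echelon form. -/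
lemma exists_isReducedEchelon (P : Submodule F (K → F)) :
    ∃ r : K → K → F, IsReducedEchelon (leadSet P) r ∧
      Submodule.span F (r '' leadSet P) = P := by
  classical
  have key : ∀ u, ∃ x ∈ P, u ∈ leadSet P →
      x u = 1 ∧ (∀ v ∈ leadSet P, v ≠ u → x v = 0) ∧ ∀ v < u, x v = 0 := by
    intro u
    by_cases hu : u ∈ leadSet P
    · obtain ⟨x, hx, hx'⟩ := exists_reduced_row P u hu
      exact ⟨x, hx, fun _ => hx'⟩
    · exact ⟨0, zero_mem _, fun h => absurd h hu⟩
  choose r hrP hr using key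
  refine ⟨r, ⟨fun u hu => (hr u hu).1, fun u hu => (hr u hu).2.1, fun u hu => (hr u hu).2.2⟩,
    le_antisymm ?_ ?_⟩
  · rw [Submodule.span_le]
    rintro _ ⟨u, _, rfl⟩
    exact hrP u
  · intro x hx
    let s : K → F := ∑ u, if u ∈ leadSet P then x u • r u else 0
    have hs : s ∈ Submodule.span F (r '' leadSet P) := by
      refine Submodule.sum_mem _ fun u _ => ?_
      split_ifs with hu
      · exact Submodule.smul_mem _ _ (Submodule.subset_span ⟨u, hu, rfl⟩)
      · exact zero_mem _
    have hsP : s ∈ P := by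
      refine Submodule.sum_mem _ fun v _ => ?_
      split_ifs
      · exact P.smul_mem _ (hrP v)
      · exact zero_mem _
    have hsx : ∀ w ∈ leadSet P, s w = x w := by
      intro w hw
      simp only [s, Finset.sum_apply]
      rw [Finset.sum_eq_single w]
      · simp [hw, (hr w hw).1]
      · intro v _ hv
        split_ifs with hv'
        · simp [(hr v hv').2.1 w hw hv.symm]
        · rfl
      · simp
    -- A first nonzero index of `x - s` would be a leading index of `P`, but `s` agrees with `x` at
    -- all of these.
    suffices h0 : ∀ w, (x - s) w = 0 by
      have : x = s := by
        rw [← sub_eq_zero]; exact funext h0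
      rw [this]; exact hs
    intro w
    induction w using WellFoundedLT.induction with
    | ind w ih =>
      by_contra hw
      have : w ∈ leadSet P := ⟨x - s, sub_mem hx hsP, hw, ih⟩
      exact hw (by simp [hsx w this])

end RowEchelon

/-! ### Labeled matroids as encodings of subspaces -/

namespace LabeledMatroid

variable {K : Type} [LinearOrder K] {F : Type*} [Field F]

open Classical in
/-- The label of an edge, extended by zero. -/
def coeff (M : LabeledMatroid K F) (u v : K) : F :=
  if h : (u, v) ∈ M.E then (M.label ⟨(u, v), h⟩ : F) else 0

lemma coeff_ne_zero_iff (M : LabeledMatroid K F) (u v : K) :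
    M.coeff u v ≠ 0 ↔ (u, v) ∈ M.E := by
  unfold coeff
  split_ifs with h <;> simp [h]

/-- The vector attached to the vertex `u`. -/
def row (M : LabeledMatroid K F) (u : K) : K → F := Pi.single u 1 + M.coeff u

/-- The vertices whose rows span the row space. -/
def pivots (M : LabeledMatroid K F) (L : K → Prop) : Set K :=
  {u | u ∈ M.U ∧ ((∃ v, (u, v) ∈ M.E) ∨ L u)}

/-- The subspace attached to a labeled matroid. -/
def rowSpace (M : LabeledMatroid K F) (L : K → Prop) : Submodule F (K → F) :=
  Submodule.span F (M.row '' M.pivots L)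

lemma disj (M : LabeledMatroid K F) {u : K} (hU : u ∈ M.U) (hV : u ∈ M.V) : False :=
  Set.disjoint_left.mp M.isCompl.disjoint hU hV

lemma coeff_eq_zero_of_mem_U (M : LabeledMatroid K F) {u v : K} (hv : v ∈ M.U) :
    M.coeff u v = 0 := by
  by_contra h
  exact M.disj hv (M.unidirectional ((M.coeff_ne_zero_iff u v).mp h)).2

lemma row_self (M : LabeledMatroid K F) {u : K} (hu : u ∈ M.U) : M.row u u = 1 := by
  simp [row, M.coeff_eq_zero_of_mem_U hu]

lemma row_of_ne (M : LabeledMatroid K F) {u v : K} (h : v ≠ u) : M.row u v = M.coeff u v := by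
  simp [row, h]

lemma isReducedEchelon (M : LabeledMatroid K F) (L : K → Prop) :
    IsReducedEchelon (M.pivots L) M.row where
  diag u hu := M.row_self hu.1
  off u _ v hv h := by rw [M.row_of_ne h, M.coeff_eq_zero_of_mem_U hv.1]
  lead u _ v h := by
    rw [M.row_of_ne h.ne]
    by_contra h'
    exact (M.increasing u v ((M.coeff_ne_zero_iff u v).mp h')).not_gt h

lemma mem_V_of_not_mem_U (M : LabeledMatroid K F) {u : K} (h : u ∉ M.U) : u ∈ M.V := by
  have : u ∈ M.U ∪ M.V := by
    have h' : M.U ∪ M.V = Set.univ := M.isCompl.sup_eq_top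
    rw [h']; trivial
  exact this.resolve_left h

lemma exists_apply_ne_zero (M : LabeledMatroid K F) (L : K → Prop) {u : K} (hu : L u) :
    ∃ x ∈ M.rowSpace L, x u ≠ 0 := by
  by_cases h : u ∈ M.U
  · exact ⟨M.row u, Submodule.subset_span ⟨u, ⟨h, Or.inr hu⟩, rfl⟩, by simp [M.row_self h]⟩
  · obtain ⟨w, hw⟩ := M.covered u (M.mem_V_of_not_mem_U h)
    have hwU := (M.unidirectional hw).1
    refine ⟨M.row w, Submodule.subset_span ⟨w, ⟨hwU, Or.inl ⟨u, hw⟩⟩, rfl⟩, ?_⟩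
    rw [M.row_of_ne (M.increasing _ _ hw).ne']
    exact (M.coeff_ne_zero_iff _ _).mpr hw

/-- Expresses `V` in terms of the row space alone, so that even the position of isolated vertices is
determined by the subspace. -/
lemma mem_V_iff [Fintype K] (M : LabeledMatroid K F) (L : K → Prop) (v : K) :
    v ∈ M.V ↔ v ∉ M.pivots L ∧ ∃ x ∈ M.rowSpace L, x v ≠ 0 := by
  classical
  constructor
  · intro hv
    refine ⟨fun h => M.disj h.1 hv, ?_⟩
    obtain ⟨w, hw⟩ := M.covered v hv
    have hwU := (M.unidirectional hw).1
    refine ⟨M.row w, Submodule.subset_span ⟨w, ⟨hwU, Or.inl ⟨v, hw⟩⟩, rfl⟩, ?_⟩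
    rw [M.row_of_ne (M.increasing _ _ hw).ne']
    exact (M.coeff_ne_zero_iff _ _).mpr hw
  · rintro ⟨hv, x, hx, hxv⟩
    rw [(M.isReducedEchelon L).expand hx, Finset.sum_apply] at hxv
    obtain ⟨u, -, hu⟩ := Finset.exists_ne_zero_of_sum_ne_zero hxv
    split_ifs at hu with hup
    · have hvu : v ≠ u := fun h => hv (h ▸ hup)
      simp only [Pi.smul_apply, smul_eq_mul, M.row_of_ne hvu] at hu
      exact (M.unidirectional ((M.coeff_ne_zero_iff u v).mp (right_ne_zero_of_mul hu))).2
    · simp at hu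

/-- A basis vector in the row space would have to be the pivot row at `u`. Since `u` is a pivot
outside `L`, an edge starts there, and that row has a second nonzero entry. -/
lemma single_notMem [Fintype K] (M : LabeledMatroid K F) (L : K → Prop) {u : K} (hu : ¬ L u) :
    Pi.single u 1 ∉ M.rowSpace L := by
  classical
  intro h
  have hp : u ∈ M.pivots L := by
    rw [← (M.isReducedEchelon L).leadSet_span]
    exact ⟨_, h, by simp, fun v hv => by simp [hv.ne]⟩
  obtain ⟨v, hv⟩ := hp.2.resolve_right hu
  have hne : v ≠ u := (M.increasing _ _ hv).ne'
  have h1 := congrFun ((M.isReducedEchelon L).expand h) v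
  rw [Finset.sum_apply, Finset.sum_eq_single u] at h1
  · simp only [hp, if_true, Pi.single_eq_same, one_smul, M.row_of_ne hne,
      Pi.single_eq_of_ne hne] at h1
    exact (M.coeff_ne_zero_iff u v).mpr hv h1.symm
  · intro w _ hw
    split_ifs <;> simp [hw]
  · simp

lemma ext_of_coeff {M M' : LabeledMatroid K F} (hV : M.V = M'.V)
    (hc : ∀ u v, M.coeff u v = M'.coeff u v) : M = M' := by
  have hU : M.U = M'.U := by
    rw [← M.isCompl.symm.compl_eq, ← M'.isCompl.symm.compl_eq, hV]
  have hE : M.E = M'.E := by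
    ext ⟨u, v⟩
    rw [← coeff_ne_zero_iff, ← coeff_ne_zero_iff, hc]
  obtain ⟨U, V, h1, E, h2, h3, h4, lab⟩ := M
  obtain ⟨U', V', h1', E', h2', h3', h4', lab'⟩ := M'
  simp only at hU hV hE
  subst hU hV hE
  congr 1
  ext ⟨⟨u, v⟩, h⟩
  have := hc u v
  simpa [coeff, h] using this

lemma eq_of_rowSpace_eq [Fintype K] {M M' : LabeledMatroid K F} {L : K → Prop}
    (h : M.rowSpace L = M'.rowSpace L) : M = M' := by
  have hp : M.pivots L = M'.pivots L := by
    rw [← (M.isReducedEchelon L).leadSet_span, ← (M'.isReducedEchelon L).leadSet_span]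
    exact congrArg leadSet h
  refine ext_of_coeff ?_ ?_
  · ext v
    rw [M.mem_V_iff L, M'.mem_V_iff L, hp, h]
  · intro u v
    by_cases hu : u ∈ M.pivots L
    · have h' : Submodule.span F (M.row '' M.pivots L) =
          Submodule.span F (M'.row '' M.pivots L) := by
        rw [rowSpace, rowSpace, ← hp] at h; exact h
      have := (M.isReducedEchelon L).row_unique (hp ▸ M'.isReducedEchelon L) h' hu
      have := congrFun this v
      simpa [row] using this
    · have h1 : M.coeff u v = 0 := by
        by_contra hc
        have hE := (M.coeff_ne_zero_iff u v).mp hc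
        exact hu ⟨(M.unidirectional hE).1, Or.inl ⟨v, hE⟩⟩
      have h2 : M'.coeff u v = 0 := by
        by_contra hc
        have hE := (M'.coeff_ne_zero_iff u v).mp hc
        exact hu (hp ▸ ⟨(M'.unidirectional hE).1, Or.inl ⟨v, hE⟩⟩)
      rw [h1, h2]

/-- Every subspace of `K → F` that is not contained in a coordinate hyperplane indexed by `L`, and
contains no standard basis vector with index outside `L`, comes from a labeled matroid. -/
lemma exists_rowSpace_eq [Fintype K] (L : K → Prop) (P : Submodule F (K → F))
    (h1 : ∀ u, L u → ∃ x ∈ P, x u ≠ 0) (h2 : ∀ u, ¬ L u → Pi.single u 1 ∉ P) :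
    ∃ M : LabeledMatroid K F, M.rowSpace L = P := by
  classical
  obtain ⟨r, hr, hP⟩ := exists_isReducedEchelon P
  have hrP : ∀ u ∈ leadSet P, r u ∈ P := fun u hu => by
    have : r u ∈ Submodule.span F (r '' leadSet P) := Submodule.subset_span ⟨u, hu, rfl⟩
    rwa [hP] at this
  let M : LabeledMatroid K F :=
    -- `U` consists of the leading indices and the coordinates vanishing on all of `P`. The latter
    -- become isolated vertices, and by `h1` they lie outside `L`, so they are not pivots.
    { U := {v | v ∉ leadSet P ∧ ∃ x ∈ P, x v ≠ 0}ᶜ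
      V := {v | v ∉ leadSet P ∧ ∃ x ∈ P, x v ≠ 0}
      isCompl := isCompl_compl.symm
      E := {e | e.1 ∈ leadSet P ∧ e.2 ∉ leadSet P ∧ r e.1 e.2 ≠ 0}
      unidirectional := by
        rintro ⟨u, v⟩ ⟨hu, hv, huv⟩
        exact ⟨fun h => h.1 hu, hv, r u, hrP u hu, huv⟩
      covered := by
        rintro v ⟨hv, x, hx, hxv⟩
        rw [← hP] at hx
        rw [hr.expand hx, Finset.sum_apply] at hxv
        obtain ⟨u, -, hu⟩ := Finset.exists_ne_zero_of_sum_ne_zero hxv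
        split_ifs at hu with hup
        · exact ⟨u, hup, hv, right_ne_zero_of_mul hu⟩
        · simp at hu
      increasing := by
        rintro u v ⟨hu, hv, huv⟩
        by_contra hle
        rcases lt_or_eq_of_le (not_lt.mp hle) with h | h
        · exact huv (hr.lead u hu v h)
        · exact hv (h ▸ hu)
      label := fun e => Units.mk0 (r e.1.1 e.1.2) e.2.2.2 }
  have hE : ∀ u v, (u, v) ∈ M.E ↔ u ∈ leadSet P ∧ v ∉ leadSet P ∧ r u v ≠ 0 :=
    fun u v => Iff.rfl
  have hcoeff : ∀ u v, (u, v) ∈ M.E → M.coeff u v = r u v := by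
    intro u v h
    simp [coeff, h, M]
  have hrow : ∀ u ∈ leadSet P, M.row u = r u := by
    intro u hu
    ext v
    by_cases hvu : v = u
    · subst hvu
      rw [M.row_self (fun h => h.1 hu), hr.diag v hu]
    · rw [M.row_of_ne hvu]
      by_cases hv : (u, v) ∈ M.E
      · exact hcoeff u v hv
      · have hc : M.coeff u v = 0 := by
          by_contra hc; exact hv ((M.coeff_ne_zero_iff u v).mp hc)
        rw [hc]
        by_contra hne
        refine hv ((hE u v).mpr ⟨hu, fun hvp => hne (hr.off u hu v hvp hvu).symm, Ne.symm hne⟩)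
  have hpiv : M.pivots L = leadSet P := by
    ext u
    constructor
    · rintro ⟨hu, ⟨v, hv⟩ | hL⟩
      · exact hv.1
      · by_contra hn
        exact hu ⟨hn, h1 u hL⟩
    · intro hu
      refine ⟨fun h => h.1 hu, ?_⟩
      by_cases hL : L u
      · exact Or.inr hL
      · left
        -- Without an edge at `u`, the reduced row at `u` would be a basis vector, which `h2`
        -- excludes.
        by_contra hno
        push Not at hno
        refine h2 u hL ?_
        have : Pi.single u 1 = r u := by
          ext v
          by_cases hvu : v = u
          · subst hvu; simp [hr.diag v hu]
          · by_contra hne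
            rw [Pi.single_eq_of_ne hvu] at hne
            exact hno v ((hE u v).mpr
              ⟨hu, fun hvp => hne (hr.off u hu v hvp hvu).symm, Ne.symm hne⟩)
        rw [this]; exact hrP u hu
  refine ⟨M, ?_⟩
  rw [rowSpace, hpiv, ← hP, hP]
  conv_rhs => rw [← hP]
  congr 1
  exact Set.image_congr hrow

end LabeledMatroid

/-! ### Weights along chains -/

section Chains

open Relation

/-- A relation that is a partial injection breaks up into chains, so equivalent elements are
comparable along the relation. -/
lemma eqvGen_total {α : Type*} {r : α → α → Prop} (h1 : ∀ a b c, r a b → r a c → b = c)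
    (h2 : ∀ a b c, r a c → r b c → a = b) {a b : α} (h : EqvGen r a b) :
    ReflTransGen r a b ∨ ReflTransGen r b a := by
  have hr : Relator.RightUnique r := fun a b c hab hac => h1 a b c hab hac
  have hl : Relator.RightUnique (Function.swap r) := fun a b c hab hac => h2 b c a hab hac
  induction h with
  | rel a b h => exact Or.inl (ReflTransGen.single h)
  | refl a => exact Or.inl ReflTransGen.refl
  | symm a b _ ih => exact ih.symm
  | trans a b c _ _ ih1 ih2 =>
    rcases ih1 with h1 | h1 <;> rcases ih2 with h2 | h2
    · exact Or.inl (h1.trans h2)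
    · have := ReflTransGen.total_of_right_unique hl (reflTransGen_swap.mpr h1)
        (reflTransGen_swap.mpr h2)
      exact this.symm.imp reflTransGen_swap.mp reflTransGen_swap.mp
    · exact ReflTransGen.total_of_right_unique hr h1 h2
    · exact Or.inr (h2.trans h1)

open Classical in
/-- The product of the labels of all steps inside `C` that end at or before `a`. -/
def chainWeight {α ι B M : Type*} [LinearOrder ι] [CommMonoid M] [Fintype B]
    (src tgt : B → α) (pos : α → ι) (l : B → M) (C : Set α) (a : α) : M :=
  ∏ b, if src b ∈ C ∧ tgt b ∈ C ∧ pos (tgt b) ≤ pos a then l b else 1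

/-- All of `C` lies on one chain along which `pos` increases strictly. Passing from the source to
the target of `b` therefore adds exactly one factor, that of `b` itself. -/
lemma chainWeight_tgt {α ι B M : Type*} [LinearOrder ι] [CommMonoid M] [Fintype B]
    {src tgt : B → α} {pos : α → ι} {l : B → M} (hs : Function.Injective src)
    (ht : Function.Injective tgt) (hpos : ∀ b, pos (src b) < pos (tgt b))
    {r : α → α → Prop} (hr : ∀ a a', r a a' ↔ ∃ b, src b = a ∧ tgt b = a')
    {C : Set α} (hC : ∀ a ∈ C, ∀ a' ∈ C, EqvGen r a a') (b : B) (h1 : src b ∈ C)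
    (h2 : tgt b ∈ C) :
    chainWeight src tgt pos l C (tgt b) = l b * chainWeight src tgt pos l C (src b) := by
  classical
  have hmono : ∀ a a', ReflTransGen r a a' → pos a ≤ pos a' := by
    intro a a' h
    induction h with
    | refl => exact le_rfl
    | tail _ h ih =>
      obtain ⟨b, rfl, rfl⟩ := (hr _ _).mp h
      exact ih.trans (hpos b).le
  have hR : ∀ a b c, r a b → r a c → b = c := by
    intro a b c hab hac
    obtain ⟨b1, rfl, rfl⟩ := (hr _ _).mp hab
    obtain ⟨b2, h, rfl⟩ := (hr _ _).mp hac
    rw [hs h]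
  have hL : ∀ a b c, r a c → r b c → a = b := by
    intro a b c hab hac
    obtain ⟨b1, rfl, rfl⟩ := (hr _ _).mp hab
    obtain ⟨b2, rfl, h⟩ := (hr _ _).mp hac
    rw [ht h]
  have key : ∀ b', tgt b' ∈ C → pos (tgt b') ≤ pos (tgt b) → b' = b ∨
      pos (tgt b') ≤ pos (src b) := by
    intro b' hb' hle
    rcases eqvGen_total hR hL (hC _ h1 _ hb') with h | h
    · rcases ReflTransGen.cases_head h with h | ⟨c, hc, hc'⟩
      · right; rw [← h]
      · left
        have hcb : c = tgt b := hR _ _ _ hc ((hr _ _).mpr ⟨b, rfl, rfl⟩)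
        subst hcb
        rcases ReflTransGen.cases_head hc' with h | ⟨d, hd, hd'⟩
        · exact (ht h).symm
        · obtain ⟨b2, h3, rfl⟩ := (hr _ _).mp hd
          have := hpos b2
          rw [h3] at this
          exact absurd (this.trans_le (hmono _ _ hd')) hle.not_gt
    · exact Or.inr (hmono _ _ h)
  unfold chainWeight
  have hl : l b = ∏ b', if b' = b then l b' else 1 := by simp
  rw [hl, ← Finset.prod_mul_distrib]
  refine Finset.prod_congr rfl fun b' _ => ?_
  by_cases hb : b' = b
  · subst hb
    simp [h1, h2, (hpos b').not_ge]
  · rw [if_neg hb, one_mul]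
    refine if_congr ?_ rfl rfl
    refine and_congr_right fun _ => and_congr_right fun h => ?_
    exact ⟨fun h' => (key b' h h').resolve_left hb, fun h' => h'.trans (hpos b).le⟩

end Chains

/-! ### Strictly upper triangular matrices -/

section Upper

variable {n : ℕ} {F : Type*} [Field F]

lemma utMk_apply (f : Fin n × Fin n → F) (i j : Fin n) :
    (utMk f).1 i j = if i < j then f (i, j) else 0 := rfl

lemma ut_apply_eq_zero (x : ut n F) {i j : Fin n} (h : j ≤ i) : x.1 i j = 0 := x.2 i j h

lemma ut_ext {x y : ut n F} (h : ∀ i j, i < j → x.1 i j = y.1 i j) : x = y := by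
  apply Subtype.ext
  ext i j
  rcases lt_or_ge i j with h' | h'
  · exact h i j h'
  · rw [ut_apply_eq_zero x h', ut_apply_eq_zero y h']

lemma utE_apply (e : Fin n × Fin n) (i j : Fin n) :
    (utE F e).1 i j = if i < j ∧ (i, j) = e then 1 else 0 := by
  rw [utE, utMk_apply, Pi.single_apply]
  split_ifs <;> simp_all

/-- The linear functional reading off an entry. -/
def utEntry (F : Type*) [Field F] (e : Fin n × Fin n) : ut n F →ₗ[F] F where
  toFun x := x.1 e.1 e.2
  map_add' _ _ := rfl
  map_smul' _ _ := rfl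

@[simp] lemma utEntry_apply (e : Fin n × Fin n) (x : ut n F) : utEntry F e x = x.1 e.1 e.2 := rfl

lemma utEntry_utE {e : Fin n × Fin n} (he : e.1 < e.2) (f : Fin n × Fin n) :
    utEntry F e (utE F f) = if e = f then 1 else 0 := by
  rw [utEntry_apply, utE_apply]
  simp [he]

lemma ut_eq_sum (x : ut n F) : x = ∑ e : Fin n × Fin n, x.1 e.1 e.2 • utE F e := by
  refine ut_ext fun i j h => ?_
  change utEntry F (i, j) x = utEntry F (i, j) _
  rw [map_sum, Finset.sum_eq_single (i, j)]
  · rw [map_smul, utEntry_utE h]; simp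
  · intro e _ he
    rw [map_smul, utEntry_utE h, if_neg he.symm, smul_zero]
  · simp

lemma mem_of_utE_mem {P : Submodule F (ut n F)} {x : ut n F}
    (h : ∀ i j, i < j → x.1 i j ≠ 0 → utE F (i, j) ∈ P) : x ∈ P := by
  rw [ut_eq_sum x]
  refine P.sum_mem fun e _ => ?_
  by_cases h0 : x.1 e.1 e.2 = 0
  · rw [h0, zero_smul]; exact zero_mem _
  · have hlt : e.1 < e.2 := by
      by_contra hle
      exact h0 (ut_apply_eq_zero x (not_lt.mp hle))
    exact P.smul_mem _ (h e.1 e.2 hlt h0)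

/-- The part of a bracket with `e_{j,k}` which moves column `j` to column `k`. -/
def colShift (x : ut n F) (j k : Fin n) : ut n F :=
  utMk fun e => if e.2 = k then x.1 e.1 j else 0

/-- The part of a bracket with `e_{j,k}` which moves row `k` to row `j`. -/
def rowShift (x : ut n F) (j k : Fin n) : ut n F :=
  utMk fun e => if e.1 = j then x.1 k e.2 else 0

lemma ut_coe_lie (x y : ut n F) : (⁅x, y⁆ : ut n F).1 = x.1 * y.1 - y.1 * x.1 := by
  rw [LieSubalgebra.coe_bracket, Ring.lie_def]

lemma lie_utE (x : ut n F) {j k : Fin n} (hjk : j < k) :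
    ⁅x, utE F (j, k)⁆ = colShift x j k - rowShift x j k := by
  apply Subtype.ext
  ext r s
  rw [ut_coe_lie]
  have h1 : (x.1 * (utE F (j, k)).1) r s = if s = k then x.1 r j else 0 := by
    rw [Matrix.mul_apply, Finset.sum_eq_single j]
    · rw [utE_apply]
      by_cases h : s = k
      · subst h; simp [hjk]
      · simp [h]
    · intro b _ hb
      rw [utE_apply]; simp [hb]
    · simp
  have h2 : ((utE F (j, k)).1 * x.1) r s = if r = j then x.1 k s else 0 := by
    rw [Matrix.mul_apply, Finset.sum_eq_single k]
    · rw [utE_apply]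
      by_cases h : r = j
      · subst h; simp [hjk]
      · simp [h]
    · intro b _ hb
      rw [utE_apply]; simp [hb]
    · simp
  rw [Matrix.sub_apply, h1, h2]
  change _ = (colShift x j k).1 r s - (rowShift x j k).1 r s
  rw [colShift, rowShift, utMk_apply, utMk_apply]
  by_cases hrs : r < s
  · simp [hrs]
  · have hsr := not_lt.mp hrs
    simp only [if_neg hrs, sub_zero]
    rw [sub_eq_zero]
    have e1 : (if s = k then x.1 r j else 0) = 0 := by
      split_ifs with h
      · subst h; exact ut_apply_eq_zero x (hjk.le.trans hsr)
      · rfl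
    have e2 : (if r = j then x.1 k s else 0) = 0 := by
      split_ifs with h
      · subst h; exact ut_apply_eq_zero x (hsr.trans hjk.le)
      · rfl
    rw [e1, e2]

/-- The subspace of matrices with entries supported in `A`. -/
def utSupp (F : Type*) [Field F] (A : Set (Fin n × Fin n)) : Submodule F (ut n F) where
  carrier := {x | ∀ e, e ∉ A → x.1 e.1 e.2 = 0}
  zero_mem' _ _ := rfl
  add_mem' {x y} hx hy e he := by
    change x.1 e.1 e.2 + y.1 e.1 e.2 = 0
    rw [hx e he, hy e he, add_zero]
  smul_mem' c x hx e he := by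
    change c * x.1 e.1 e.2 = 0
    rw [hx e he, mul_zero]

lemma mem_of_mem_utSupp {A : Set (Fin n × Fin n)} {x : ut n F} (hx : x ∈ utSupp F A)
    {e : Fin n × Fin n} (h : x.1 e.1 e.2 ≠ 0) : e ∈ A := by
  by_contra he
  exact h (hx e he)

lemma utE_mem_utSupp {A : Set (Fin n × Fin n)} {e : Fin n × Fin n} (he : e ∈ A) :
    utE F e ∈ utSupp F A := by
  intro f hf
  rw [utE_apply, if_neg]
  rintro ⟨_, h⟩
  have h' : f = e := h
  exact hf (h' ▸ he)

end Upper

/-! ### Upper sets of nonnesting set partitions -/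

section UpSet

variable {n : ℕ} {F : Type*} [Field F] {lam : Set (Fin n × Fin n)}

lemma upSet_anti {l m : ℕ} (h : l ≤ m) : upSet lam m ⊆ upSet lam l := by
  rintro f ⟨h1, e, he, h2, h3⟩
  exact ⟨h1, e, he, h2, le_trans (by omega) h3⟩

lemma upSet_add {l m : ℕ} {f g : Fin n × Fin n} (hf : f ∈ upSet lam l) (h1 : g.1 ≤ f.1)
    (h2 : f.2 ≤ g.2) (h3 : (f.2 : ℕ) - (f.1 : ℕ) + m ≤ (g.2 : ℕ) - (g.1 : ℕ)) :
    g ∈ upSet lam (l + m) := by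
  obtain ⟨hlt, e, he, h4, h5⟩ := hf
  unfold leE at h4
  unfold edgeHt at h5
  have hlt' : f.1 < f.2 := hlt
  exact ⟨h1.trans_lt (hlt'.trans_le h2), e, he, ⟨h1.trans h4.1, h4.2.trans h2⟩,
    by unfold edgeHt; omega⟩

lemma subset_upSet_zero (h : lam ⊆ incEdges n) : lam ⊆ upSet lam 0 :=
  fun e he => ⟨h he, e, he, ⟨le_rfl, le_rfl⟩, by simp⟩

namespace IsNonnesting

variable (h : IsNonnesting lam)
include h

lemma lt {i j : Fin n} (hij : (i, j) ∈ lam) : i < j := h.increasing hij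

lemma eq_of_le {e f : Fin n × Fin n} (he : e ∈ lam) (hf : f ∈ lam) (h1 : f.1 ≤ e.1)
    (h2 : e.2 ≤ f.2) : e = f := h.antichain.eq he hf ⟨h1, h2⟩

lemma left_unique {i i' j : Fin n} (h1 : (i, j) ∈ lam) (h2 : (i', j) ∈ lam) : i = i' := by
  rcases le_total i i' with hle | hle
  · exact (congrArg Prod.fst (h.eq_of_le h2 h1 hle le_rfl)).symm
  · exact congrArg Prod.fst (h.eq_of_le h1 h2 hle le_rfl)

lemma right_unique {i j j' : Fin n} (h1 : (i, j) ∈ lam) (h2 : (i, j') ∈ lam) : j = j' := by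
  rcases le_total j j' with hle | hle
  · exact congrArg Prod.snd (h.eq_of_le h1 h2 le_rfl hle)
  · exact (congrArg Prod.snd (h.eq_of_le h2 h1 le_rfl hle)).symm

lemma notMem_upSet {e : Fin n × Fin n} (he : e ∈ lam) {l : ℕ} (hl : 0 < l) :
    e ∉ upSet lam l := by
  rintro ⟨_, f, hf, h1, h2⟩
  rw [h.eq_of_le hf he h1.1 h1.2] at h2
  omega

lemma mem_upSet_one {e : Fin n × Fin n} (he : e ∈ upSet lam 0) (hn : e ∉ lam) :
    e ∈ upSet lam 1 := by
  obtain ⟨hlt, f, hf, h1, h2⟩ := he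
  refine ⟨hlt, f, hf, h1, ?_⟩
  by_contra hc
  unfold leE at h1
  unfold edgeHt at hc
  have h3 := h.lt (i := f.1) (j := f.2) hf
  have h4 : e.1 < e.2 := hlt
  have e1 : e.1 = f.1 := by ext; omega
  have e2 : e.2 = f.2 := by ext; omega
  exact hn ((Prod.ext e1 e2 : e = f) ▸ hf)

/-- An edge above `λ` but outside it already has excess height at least one, and prolonging it adds
at least one more. Hence, modulo `upSet lam 2`, a bracket sees only the entries of `x` at edges of
`λ`. -/
lemma col_mem_upSet_two {r j k : Fin n} (hjk : j < k) (he : (r, j) ∈ upSet lam 0)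
    (hn : (r, j) ∉ lam) : (r, k) ∈ upSet lam 2 := by
  have hlt : r < j := he.1
  exact upSet_add (h.mem_upSet_one he hn) (m := 1) (g := (r, k)) le_rfl hjk.le
    (by simp only; omega)

lemma row_mem_upSet_two {j k s : Fin n} (hjk : j < k) (he : (k, s) ∈ upSet lam 0)
    (hn : (k, s) ∉ lam) : (j, s) ∈ upSet lam 2 := by
  have hlt : k < s := he.1
  exact upSet_add (h.mem_upSet_one he hn) (m := 1) (g := (j, s)) hjk.le le_rfl
    (by simp only; omega)

lemma col_mem_upSet_one {i j k : Fin n} (hjk : j < k) (he : (i, j) ∈ lam) :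
    (i, k) ∈ upSet lam 1 :=
  upSet_add (l := 0) (subset_upSet_zero h.increasing he) (m := 1) (g := (i, k)) le_rfl hjk.le
    (by have := h.lt he; simp only; omega)

lemma row_mem_upSet_one {j k l : Fin n} (hjk : j < k) (he : (k, l) ∈ lam) :
    (j, l) ∈ upSet lam 1 :=
  upSet_add (l := 0) (subset_upSet_zero h.increasing he) (m := 1) (g := (j, l)) hjk.le le_rfl
    (by have := h.lt he; simp only; omega)

/-- An edge of height one above `lam` covers an edge of `lam`. -/
lemma exists_cover {i k : Fin n} (he : (i, k) ∈ upSet lam 0) (hn : (i, k) ∉ lam)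
    (h2 : (i, k) ∉ upSet lam 2) :
    (∃ j, (i, j) ∈ lam ∧ (j : ℕ) + 1 = k) ∨ ∃ j, (j, k) ∈ lam ∧ (i : ℕ) + 1 = j := by
  obtain ⟨hlt, ⟨a, b⟩, hf, h1, h3⟩ := h.mem_upSet_one he hn
  have hab := h.lt hf
  unfold leE at h1
  unfold edgeHt at h3
  simp only at h1 h3
  have hc : ¬ ((b : ℕ) - a + 2 ≤ (k : ℕ) - i) := fun hc => h2 ⟨hlt, (a, b), hf, h1, hc⟩
  rcases eq_or_lt_of_le h1.1 with e1 | e1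
  · subst e1
    exact Or.inl ⟨b, hf, by omega⟩
  · have : b = k := by ext; omega
    subst this
    exact Or.inr ⟨a, hf, by omega⟩

variable {Q : Submodule F (ut n F)} (hQ : ∀ f ∈ upSet lam 2, utE F f ∈ Q) {x : ut n F}
  (hx : x ∈ utSupp F (upSet lam 0)) {j k : Fin n} (hjk : j < k)
include hQ hx hjk

/-- Among the entries of column `j`, those off `λ` move into `upSet lam 2`, and `(i, j)` is the only
edge of `λ` ending at `j`. This and its row analogue give the bracket formula modulo `upSet lam 2`.
-/
lemma colShift_sub_mem {i : Fin n} (hij : (i, j) ∈ lam) :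
    colShift x j k - x.1 i j • utE F (i, k) ∈ Q := by
  refine mem_of_utE_mem fun r s hrs hne => ?_
  have hik : i < k := (h.lt hij).trans hjk
  change (colShift x j k).1 r s - x.1 i j * (utE F (i, k)).1 r s ≠ 0 at hne
  rw [colShift, utMk_apply, if_pos hrs, utE_apply] at hne
  by_cases hs : s = k
  · subst hs
    by_cases hr : r = i
    · subst hr; simp [hrs] at hne
    · simp only [hr, if_true, Prod.mk.injEq, and_true, and_false, if_false, mul_zero,
        sub_zero] at hne
      exact hQ _ (h.col_mem_upSet_two hjk (mem_of_mem_utSupp hx (e := (r, j)) hne)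
        fun hc => hr (h.left_unique hc hij))
  · simp [hs] at hne

lemma rowShift_sub_mem {l : Fin n} (hkl : (k, l) ∈ lam) :
    rowShift x j k - x.1 k l • utE F (j, l) ∈ Q := by
  refine mem_of_utE_mem fun r s hrs hne => ?_
  change (rowShift x j k).1 r s - x.1 k l * (utE F (j, l)).1 r s ≠ 0 at hne
  rw [rowShift, utMk_apply, if_pos hrs, utE_apply] at hne
  by_cases hr : r = j
  · subst hr
    by_cases hs : s = l
    · subst hs; simp [hrs] at hne
    · simp only [hs, if_true, Prod.mk.injEq, and_false, if_false, mul_zero,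
        sub_zero] at hne
      exact hQ _ (h.row_mem_upSet_two hjk (mem_of_mem_utSupp hx (e := (k, s)) hne)
        fun hc => hs (h.right_unique hc hkl))
  · simp [hr] at hne

lemma colShift_mem (hc : ∀ i, (i, j) ∈ lam → utE F (i, k) ∈ Q) : colShift x j k ∈ Q := by
  refine mem_of_utE_mem fun r s hrs hne => ?_
  rw [colShift, utMk_apply, if_pos hrs] at hne
  simp only [ne_eq, ite_eq_right_iff, Classical.not_imp] at hne
  obtain ⟨rfl, hne⟩ := hne
  by_cases hr : (r, j) ∈ lam
  · exact hc r hr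
  · exact hQ _ (h.col_mem_upSet_two hjk (mem_of_mem_utSupp hx (e := (r, j)) hne) hr)

lemma rowShift_mem (hc : ∀ l, (k, l) ∈ lam → utE F (j, l) ∈ Q) : rowShift x j k ∈ Q := by
  refine mem_of_utE_mem fun r s hrs hne => ?_
  rw [rowShift, utMk_apply, if_pos hrs] at hne
  simp only [ne_eq, ite_eq_right_iff, Classical.not_imp] at hne
  obtain ⟨rfl, hne⟩ := hne
  by_cases hr : (k, s) ∈ lam
  · exact hc s hr
  · exact hQ _ (h.row_mem_upSet_two hjk (mem_of_mem_utSupp hx (e := (k, s)) hne) hr)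

end IsNonnesting

end UpSet

/-! ### Rows and columns of a tight splice -/

namespace IsSetPartition

variable {n : ℕ} {nu : Set (Fin n × Fin n)} (h : IsSetPartition nu)
include h

lemma left_unique {i i' j : Fin n} (h1 : (i, j) ∈ nu) (h2 : (i', j) ∈ nu) : i = i' := by
  rcases le_total i i' with hle | hle
  · exact (congrArg Prod.fst (h.antichainL.eq h2 h1 ⟨hle, rfl⟩)).symm
  · exact congrArg Prod.fst (h.antichainL.eq h1 h2 ⟨hle, rfl⟩)

lemma right_unique {i j j' : Fin n} (h1 : (i, j) ∈ nu) (h2 : (i, j') ∈ nu) : j = j' := by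
  rcases le_total j j' with hle | hle
  · exact congrArg Prod.snd (h.antichainR.eq h1 h2 ⟨rfl, hle⟩)
  · exact (congrArg Prod.snd (h.antichainR.eq h2 h1 ⟨rfl, hle⟩)).symm

end IsSetPartition

namespace TightSplice

open Relation

variable {n : ℕ} (S : TightSplice n)

/-- The first horizontal edge of a binding. -/
def colSrc (b : S.bind) : Fin n × Fin n := (b.1.1, b.1.2.1)

/-- The second horizontal edge of a binding. -/
def colTgt (b : S.bind) : Fin n × Fin n := (b.1.2.2.1, b.1.2.2.2)

/-- The first vertical edge of a binding. -/
def rowSrc (b : S.bind) : Fin n × Fin n := (b.1.1, b.1.2.2.1)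

/-- The second vertical edge of a binding. -/
def rowTgt (b : S.bind) : Fin n × Fin n := (b.1.2.1, b.1.2.2.2)

lemma colSrc_mem (b : S.bind) : S.colSrc b ∈ S.lam := b.2.1
lemma colTgt_mem (b : S.bind) : S.colTgt b ∈ S.lam := b.2.2.1
lemma rowSrc_mem (b : S.bind) : S.rowSrc b ∈ S.nu := b.2.2.2.1
lemma rowTgt_mem (b : S.bind) : S.rowTgt b ∈ S.nu := b.2.2.2.2.1

lemma colSrc_injective : Function.Injective S.colSrc := by
  rintro ⟨⟨i, j, k, l⟩, h1, h2, h3, h4, h5⟩ ⟨⟨i', j', k', l'⟩, h1', h2', h3', h4', h5'⟩ h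
  simp only [colSrc, Prod.mk.injEq] at *
  obtain ⟨rfl, rfl⟩ := h
  obtain rfl := S.nu_setPartition.right_unique h3 h3'
  obtain rfl := S.lam_nonnesting.right_unique h2 h2'
  rfl

lemma colTgt_injective : Function.Injective S.colTgt := by
  rintro ⟨⟨i, j, k, l⟩, h1, h2, h3, h4, h5⟩ ⟨⟨i', j', k', l'⟩, h1', h2', h3', h4', h5'⟩ h
  simp only [colTgt, Prod.mk.injEq] at *
  obtain ⟨rfl, rfl⟩ := h
  obtain rfl := S.nu_setPartition.left_unique h4 h4'
  obtain rfl := S.lam_nonnesting.left_unique h1 h1'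
  rfl

lemma rowSrc_injective : Function.Injective S.rowSrc := by
  rintro ⟨⟨i, j, k, l⟩, h1, h2, h3, h4, h5⟩ ⟨⟨i', j', k', l'⟩, h1', h2', h3', h4', h5'⟩ h
  simp only [rowSrc, Prod.mk.injEq] at *
  obtain ⟨rfl, rfl⟩ := h
  obtain rfl := S.lam_nonnesting.right_unique h2 h2'
  obtain rfl := S.nu_setPartition.left_unique h4 h4'
  rfl

lemma rowTgt_injective : Function.Injective S.rowTgt := by
  rintro ⟨⟨i, j, k, l⟩, h1, h2, h3, h4, h5⟩ ⟨⟨i', j', k', l'⟩, h1', h2', h3', h4', h5'⟩ h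
  simp only [rowTgt, Prod.mk.injEq] at *
  obtain ⟨rfl, rfl⟩ := h
  obtain rfl := S.lam_nonnesting.left_unique h2 h2'
  obtain rfl := S.nu_setPartition.left_unique h3 h3'
  rfl

lemma colStep_iff (e f : Fin n × Fin n) :
    S.colStep e f ↔ ∃ b, S.colSrc b = e ∧ S.colTgt b = f :=
  ⟨fun h => ⟨⟨_, h⟩, rfl, rfl⟩, by rintro ⟨b, rfl, rfl⟩; exact b.2⟩

lemma rowStep_iff (e f : Fin n × Fin n) :
    S.rowStep e f ↔ ∃ b, S.rowSrc b = e ∧ S.rowTgt b = f :=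
  ⟨fun h => ⟨⟨_, h⟩, rfl, rfl⟩, by rintro ⟨b, rfl, rfl⟩; exact b.2⟩

lemma colSrc_lt (b : S.bind) : (S.colSrc b).1 < (S.colTgt b).1 :=
  (S.lam_nonnesting.lt (S.colSrc_mem b)).trans b.2.2.2.2.2

lemma rowSrc_lt (b : S.bind) : (S.rowSrc b).1 < (S.rowTgt b).1 :=
  S.lam_nonnesting.lt (S.colSrc_mem b)

variable {S}

lemma subset_lam_of_mem_cols {C : Set (Fin n × Fin n)} (hC : C ∈ S.cols) : C ⊆ S.lam := by
  obtain ⟨e, _, rfl⟩ := hC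
  exact fun f hf => hf.1

lemma subset_nu_of_mem_rows {R : Set (Fin n × Fin n)} (hR : R ∈ S.rows) : R ⊆ S.nu := by
  obtain ⟨e, _, rfl⟩ := hR
  exact fun f hf => hf.1

lemma eqvGen_of_mem_cols {C : Set (Fin n × Fin n)} (hC : C ∈ S.cols) :
    ∀ e ∈ C, ∀ f ∈ C, EqvGen S.colStep e f := by
  obtain ⟨e, _, rfl⟩ := hC
  exact fun f hf g hg => (EqvGen.symm _ _ hf.2).trans _ _ _ hg.2

lemma eqvGen_of_mem_rows {R : Set (Fin n × Fin n)} (hR : R ∈ S.rows) :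
    ∀ e ∈ R, ∀ f ∈ R, EqvGen S.rowStep e f := by
  obtain ⟨e, _, rfl⟩ := hR
  exact fun f hf g hg => (EqvGen.symm _ _ hf.2).trans _ _ _ hg.2

lemma mem_cols_of_eqvGen {C : Set (Fin n × Fin n)} (hC : C ∈ S.cols) {e f : Fin n × Fin n}
    (he : e ∈ C) (hf : f ∈ S.lam) (h : EqvGen S.colStep e f) : f ∈ C := by
  obtain ⟨g, _, rfl⟩ := hC
  exact ⟨hf, he.2.trans _ _ _ h⟩

lemma mem_rows_of_eqvGen {R : Set (Fin n × Fin n)} (hR : R ∈ S.rows) {e f : Fin n × Fin n}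
    (he : e ∈ R) (hf : f ∈ S.nu) (h : EqvGen S.rowStep e f) : f ∈ R := by
  obtain ⟨g, _, rfl⟩ := hR
  exact ⟨hf, he.2.trans _ _ _ h⟩

lemma nonempty_of_mem_cols {C : Set (Fin n × Fin n)} (hC : C ∈ S.cols) : C.Nonempty := by
  obtain ⟨e, he, rfl⟩ := hC
  exact ⟨e, he, EqvGen.refl _⟩

lemma nonempty_of_mem_rows {R : Set (Fin n × Fin n)} (hR : R ∈ S.rows) : R.Nonempty := by
  obtain ⟨e, he, rfl⟩ := hR
  exact ⟨e, he, EqvGen.refl _⟩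

lemma exists_mem_cols {e : Fin n × Fin n} (he : e ∈ S.lam) : ∃ C ∈ S.cols, e ∈ C :=
  ⟨_, ⟨e, he, rfl⟩, he, EqvGen.refl _⟩

lemma exists_mem_rows {e : Fin n × Fin n} (he : e ∈ S.nu) : ∃ R ∈ S.rows, e ∈ R :=
  ⟨_, ⟨e, he, rfl⟩, he, EqvGen.refl _⟩

lemma cols_eq {C C' : Set (Fin n × Fin n)} (hC : C ∈ S.cols) (hC' : C' ∈ S.cols)
    {e : Fin n × Fin n} (he : e ∈ C) (he' : e ∈ C') : C = C' := by
  ext f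
  exact ⟨fun hf => mem_cols_of_eqvGen hC' he' (subset_lam_of_mem_cols hC hf)
      (eqvGen_of_mem_cols hC _ he _ hf),
    fun hf => mem_cols_of_eqvGen hC he (subset_lam_of_mem_cols hC' hf)
      (eqvGen_of_mem_cols hC' _ he' _ hf)⟩

lemma rows_eq {R R' : Set (Fin n × Fin n)} (hR : R ∈ S.rows) (hR' : R' ∈ S.rows)
    {e : Fin n × Fin n} (he : e ∈ R) (he' : e ∈ R') : R = R' := by
  ext f
  exact ⟨fun hf => mem_rows_of_eqvGen hR' he' (subset_nu_of_mem_rows hR hf)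
      (eqvGen_of_mem_rows hR _ he _ hf),
    fun hf => mem_rows_of_eqvGen hR he (subset_nu_of_mem_rows hR' hf)
      (eqvGen_of_mem_rows hR' _ he' _ hf)⟩

lemma colSrc_mem_iff {C : Set (Fin n × Fin n)} (hC : C ∈ S.cols) (b : S.bind) :
    S.colSrc b ∈ C ↔ S.colTgt b ∈ C := by
  have h : EqvGen S.colStep (S.colSrc b) (S.colTgt b) := EqvGen.rel _ _ b.2
  exact ⟨fun h' => mem_cols_of_eqvGen hC h' (S.colTgt_mem b) h,
    fun h' => mem_cols_of_eqvGen hC h' (S.colSrc_mem b) (h.symm _ _)⟩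

lemma rowSrc_mem_iff {R : Set (Fin n × Fin n)} (hR : R ∈ S.rows) (b : S.bind) :
    S.rowSrc b ∈ R ↔ S.rowTgt b ∈ R := by
  have h : EqvGen S.rowStep (S.rowSrc b) (S.rowTgt b) := EqvGen.rel _ _ b.2
  exact ⟨fun h' => mem_rows_of_eqvGen hR h' (S.rowTgt_mem b) h,
    fun h' => mem_rows_of_eqvGen hR h' (S.rowSrc_mem b) (h.symm _ _)⟩

variable (S)

lemma notMem_nu {e : Fin n × Fin n} (he : e ∈ S.lam) : e ∉ S.nu :=
  Set.disjoint_left.mp S.disjoint he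

lemma notMem_upSet_two {e : Fin n × Fin n} (he : e ∈ S.lam ∪ S.nu) : e ∉ upSet S.lam 2 := by
  intro h
  have : e ∈ (S.lam ∪ S.nu) ∩ upSet S.lam 2 := ⟨he, h⟩
  rw [S.tight] at this
  exact this

lemma nu_lt {e : Fin n × Fin n} (he : e ∈ S.nu) : e.1 < e.2 := S.nu_setPartition.increasing he

lemma lam_lt {e : Fin n × Fin n} (he : e ∈ S.lam) : e.1 < e.2 := S.lam_nonnesting.increasing he

lemma nu_subset_upSet : S.nu ⊆ upSet S.lam 0 := by
  rintro ⟨i, k⟩ he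
  obtain ⟨j, hij, hjk, h | h⟩ := S.splice_one i k he
  · exact upSet_anti zero_le_one (S.lam_nonnesting.col_mem_upSet_one hjk h)
  · exact upSet_anti zero_le_one (S.lam_nonnesting.row_mem_upSet_one hij h)

end TightSplice

/-! ### The subspace attached to a datum -/

namespace IdealDatum

open Relation

variable {n : ℕ} {ord : ∀ S : TightSplice n, LinearOrder S.CR} {F : Type*} [Field F]
  (t : IdealDatum ord F)

/-- The largest subspace attached to a labeled tight splice: matrices supported above `lam` whose
entries at the horizontal edges of each binding are proportional. -/
def hull : Submodule F (ut n F) where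
  carrier := {x | x ∈ utSupp F (upSet t.S.lam 0) ∧ ∀ b : t.S.bind,
    utEntry F (t.S.colTgt b) x = (t.sig b : F) * utEntry F (t.S.colSrc b) x}
  zero_mem' := ⟨zero_mem _, fun b => by simp only [map_zero, mul_zero]⟩
  add_mem' {x y} hx hy := ⟨add_mem hx.1 hy.1, fun b => by
    rw [map_add, map_add, hx.2, hy.2, mul_add]⟩
  smul_mem' c x hx := ⟨Submodule.smul_mem _ c hx.1, fun b => by
    rw [map_smul, map_smul, hx.2, smul_eq_mul, smul_eq_mul]; ring⟩

lemma utE_mem_D {e : Fin n × Fin n} (he : e ∈ upSet t.S.lam 0) (h1 : e ∉ t.S.lam)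
    (h2 : e ∉ t.S.nu) : utE F e ∈ t.D :=
  Submodule.mem_sup_left (Submodule.subset_span ⟨e, ⟨he, by simp [h1, h2]⟩, rfl⟩)

lemma utE_mem_D_of_mem_upSet_two {e : Fin n × Fin n} (he : e ∈ upSet t.S.lam 2) :
    utE F e ∈ t.D :=
  t.utE_mem_D (upSet_anti (Nat.zero_le 2) he)
    (fun h => t.S.notMem_upSet_two (Or.inl h) he) (fun h => t.S.notMem_upSet_two (Or.inr h) he)

lemma utE_sub_mem_D (b : t.S.bind) :
    utE F (t.S.rowSrc b) - (t.sig b : F) • utE F (t.S.rowTgt b) ∈ t.D :=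
  Submodule.mem_sup_right (Submodule.subset_span ⟨b, rfl⟩)

lemma D_le_iff {P : Submodule F (ut n F)} :
    t.D ≤ P ↔ (∀ e ∈ upSet t.S.lam 0, e ∉ t.S.lam → e ∉ t.S.nu → utE F e ∈ P) ∧
      ∀ b, utE F (t.S.rowSrc b) - (t.sig b : F) • utE F (t.S.rowTgt b) ∈ P := by
  constructor
  · exact fun h => ⟨fun e he h1 h2 => h (t.utE_mem_D he h1 h2), fun b => h (t.utE_sub_mem_D b)⟩
  · rintro ⟨h1, h2⟩
    refine sup_le ?_ ?_
    · rw [Submodule.span_le]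
      rintro _ ⟨e, ⟨he, hn⟩, rfl⟩
      exact h1 e he (fun h => hn (Or.inl h)) (fun h => hn (Or.inr h))
    · rw [Submodule.span_le]
      rintro _ ⟨b, rfl⟩
      exact h2 b

lemma D_le_utSupp : t.D ≤ utSupp F (upSet t.S.lam 0 \ t.S.lam) := by
  rw [D_le_iff]
  have h : ∀ e ∈ t.S.nu, utE F e ∈ utSupp F (upSet t.S.lam 0 \ t.S.lam) := fun e he =>
    utE_mem_utSupp ⟨t.S.nu_subset_upSet he, fun h => t.S.notMem_nu h he⟩
  exact ⟨fun e he h1 _ => utE_mem_utSupp ⟨he, h1⟩, fun b => sub_mem (h _ (t.S.rowSrc_mem b))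
    (Submodule.smul_mem _ _ (h _ (t.S.rowTgt_mem b)))⟩

lemma mem_hull_of_mem_utSupp {x : ut n F} (hx : x ∈ utSupp F (upSet t.S.lam 0 \ t.S.lam)) :
    x ∈ t.hull := by
  refine ⟨fun e he => hx e fun h => he h.1, fun b => ?_⟩
  rw [utEntry_apply, utEntry_apply, hx _ fun h => h.2 (t.S.colTgt_mem b),
    hx _ fun h => h.2 (t.S.colSrc_mem b), mul_zero]

lemma D_le_hull : t.D ≤ t.hull := fun _ hx => t.mem_hull_of_mem_utSupp (t.D_le_utSupp hx)

/-- The coefficient of an edge of a column `C` in `b_C`. -/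
def colWeight (C : Set (Fin n × Fin n)) (e : Fin n × Fin n) : F :=
  open Classical in
  ((chainWeight t.S.colSrc t.S.colTgt Prod.fst t.sig C e : Fˣ) : F)

lemma colWeight_ne_zero (C : Set (Fin n × Fin n)) (e : Fin n × Fin n) : t.colWeight C e ≠ 0 :=
  Units.ne_zero _

lemma colWeight_tgt {C : Set (Fin n × Fin n)} (hC : C ∈ t.S.cols) (b : t.S.bind)
    (h : t.S.colSrc b ∈ C) : t.colWeight C (t.S.colTgt b) =
      (t.sig b : F) * t.colWeight C (t.S.colSrc b) := by
  classical
  unfold colWeight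
  rw [chainWeight_tgt t.S.colSrc_injective t.S.colTgt_injective t.S.colSrc_lt t.S.colStep_iff
    (TightSplice.eqvGen_of_mem_cols hC) b h ((TightSplice.colSrc_mem_iff hC b).mp h),
    Units.val_mul]

/-- The coefficients of a linear functional on rows which vanishes on `D`. -/
def rowWeight (R : Set (Fin n × Fin n)) (e : Fin n × Fin n) : F :=
  open Classical in
  ((chainWeight t.S.rowSrc t.S.rowTgt Prod.fst (fun b => (t.sig b)⁻¹) R e : Fˣ) : F)

lemma rowWeight_ne_zero (R : Set (Fin n × Fin n)) (e : Fin n × Fin n) : t.rowWeight R e ≠ 0 :=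
  Units.ne_zero _

/-- The inverse labels in the weight are what makes the functional kill `e_{i,k} - σ e_{j,l}`. -/
lemma rowWeight_tgt {R : Set (Fin n × Fin n)} (hR : R ∈ t.S.rows) (b : t.S.bind)
    (h : t.S.rowSrc b ∈ R) : (t.sig b : F) * t.rowWeight R (t.S.rowTgt b) =
      t.rowWeight R (t.S.rowSrc b) := by
  classical
  unfold rowWeight
  rw [chainWeight_tgt t.S.rowSrc_injective t.S.rowTgt_injective t.S.rowSrc_lt t.S.rowStep_iff
    (TightSplice.eqvGen_of_mem_rows hR) b h ((TightSplice.rowSrc_mem_iff hR b).mp h),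
    Units.val_mul]
  simp

open Classical in
lemma utEntry_bCol {C : Set (Fin n × Fin n)} {e : Fin n × Fin n} (he : e.1 < e.2) :
    utEntry F e (t.bCol C) = if e ∈ C then t.colWeight C e else 0 := by
  rw [utEntry_apply, bCol, utMk_apply, if_pos he]
  refine if_congr Iff.rfl ?_ rfl
  rw [colWeight, chainWeight, Units.coe_prod]
  refine Finset.prod_congr rfl fun b _ => ?_
  rw [apply_ite Units.val]
  exact if_congr Iff.rfl rfl rfl

lemma bCol_mem_hull {C : Set (Fin n × Fin n)} (hC : C ∈ t.S.cols) : t.bCol C ∈ t.hull := by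
  classical
  refine ⟨fun e he => ?_, fun b => ?_⟩
  · rcases lt_or_ge e.1 e.2 with h | h
    · have := t.utEntry_bCol (C := C) h
      rw [if_neg] at this
      · exact this
      · exact fun hc => he (subset_upSet_zero t.S.lam_nonnesting.increasing
          (TightSplice.subset_lam_of_mem_cols hC hc))
    · exact ut_apply_eq_zero _ h
  · rw [t.utEntry_bCol (t.S.lam_lt (t.S.colTgt_mem b)),
      t.utEntry_bCol (t.S.lam_lt (t.S.colSrc_mem b))]
    by_cases h : t.S.colSrc b ∈ C
    · rw [if_pos h, if_pos ((TightSplice.colSrc_mem_iff hC b).mp h), t.colWeight_tgt hC b h]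
    · rw [if_neg h, if_neg (fun h' => h ((TightSplice.colSrc_mem_iff hC b).mpr h')), mul_zero]

lemma exists_bRow_eq {S : TightSplice n} {R : Set (Fin n × Fin n)} (hR : R ∈ S.rows) :
    ∃ e ∈ R, bRow R = utE F e := by
  classical
  obtain ⟨e, he, hmin⟩ := Set.exists_min_image R Prod.fst (Set.toFinite R)
    (TightSplice.nonempty_of_mem_rows hR)
  refine ⟨e, he, ut_ext fun i j hij => ?_⟩
  rw [bRow, utMk_apply, if_pos hij, utE_apply]
  refine if_congr ⟨?_, ?_⟩ rfl rfl
  · rintro ⟨h1, h2⟩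
    refine ⟨hij, ?_⟩
    have h3 : i = e.1 := le_antisymm (h2 e he) (hmin _ h1)
    subst h3
    exact Prod.ext rfl (S.nu_setPartition.right_unique (TightSplice.subset_nu_of_mem_rows hR h1)
      (TightSplice.subset_nu_of_mem_rows hR he))
  · rintro ⟨_, rfl⟩
    exact ⟨he, hmin⟩

open Classical in
/-- The linear map sending the basis vector of a column or row to the corresponding matrix. -/
def comb : (t.S.CR → F) →ₗ[F] ut n F where
  toFun f := ∑ x, f x • t.bVec x
  map_add' f g := by simp only [Pi.add_apply, add_smul, Finset.sum_add_distrib]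
  map_smul' c f := by
    simp only [Pi.smul_apply, smul_eq_mul, mul_smul, RingHom.id_apply, Finset.smul_sum]

open Classical in
lemma comb_apply (f : t.S.CR → F) : t.comb f = ∑ x, f x • t.bVec x := rfl

lemma comb_single {_ : DecidableEq t.S.CR} (u : t.S.CR) : t.comb (Pi.single u 1) = t.bVec u := by
  classical
  rw [comb_apply, Finset.sum_eq_single u]
  · simp
  · intro v _ hv; simp [hv]
  · simp

lemma bVec_mem_hull (u : t.S.CR) : t.bVec u ∈ t.hull := by
  rcases u with C | R
  · exact t.bCol_mem_hull C.2
  · obtain ⟨e, he, h⟩ := exists_bRow_eq (F := F) R.2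
    change bRow R.1 ∈ _
    have he' := TightSplice.subset_nu_of_mem_rows R.2 he
    rw [h]
    exact t.mem_hull_of_mem_utSupp (utE_mem_utSupp
      ⟨t.S.nu_subset_upSet he', fun h => t.S.notMem_nu h he'⟩)

lemma comb_mem_hull (f : t.S.CR → F) : t.comb f ∈ t.hull := by
  classical
  exact Submodule.sum_mem _ fun u _ => Submodule.smul_mem _ _ (t.bVec_mem_hull u)

lemma utEntry_comb {C : t.S.cols} {e : Fin n × Fin n} (he : e ∈ C.1) (f : t.S.CR → F) :
    utEntry F e (t.comb f) = f (Sum.inl C) * t.colWeight C.1 e := by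
  classical
  have hel := TightSplice.subset_lam_of_mem_cols C.2 he
  have hlt := t.S.lam_lt hel
  rw [comb_apply, map_sum, Finset.sum_eq_single (Sum.inl C)]
  · rw [map_smul, smul_eq_mul]
    congr 1
    exact (t.utEntry_bCol hlt).trans (if_pos he)
  · rintro (C' | R) _ hne
    · rw [map_smul, smul_eq_mul]
      convert mul_zero _
      refine (t.utEntry_bCol hlt).trans (if_neg fun h => hne ?_)
      exact congrArg Sum.inl (Subtype.ext (TightSplice.cols_eq C'.2 C.2 h he))
    · rw [map_smul, smul_eq_mul]
      convert mul_zero _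
      obtain ⟨e', he', h⟩ := exists_bRow_eq (F := F) R.2
      change utEntry F e (bRow R.1) = 0
      rw [h, utEntry_utE hlt, if_neg]
      rintro rfl
      exact t.S.notMem_nu hel (TightSplice.subset_nu_of_mem_rows R.2 he')
  · simp

open Classical in
/-- A linear functional which vanishes on `D` and on all `b_x` except for `x = R`. -/
def rowFun (R : Set (Fin n × Fin n)) : ut n F →ₗ[F] F :=
  ∑ e : Fin n × Fin n, if e ∈ R then t.rowWeight R e • utEntry F e else 0

lemma rowFun_eq_zero {R : Set (Fin n × Fin n)} {x : ut n F}
    (h : ∀ e ∈ R, utEntry F e x = 0) : t.rowFun R x = 0 := by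
  classical
  rw [rowFun, LinearMap.sum_apply]
  refine Finset.sum_eq_zero fun e _ => ?_
  split_ifs with he
  · rw [LinearMap.smul_apply, h e he, smul_zero]
  · rfl

lemma rowFun_utE {R : Set (Fin n × Fin n)} (hR : R ∈ t.S.rows) {e : Fin n × Fin n} (he : e ∈ R) :
    t.rowFun R (utE F e) = t.rowWeight R e := by
  classical
  have hlt : ∀ f ∈ R, f.1 < f.2 := fun f hf =>
    t.S.nu_lt (TightSplice.subset_nu_of_mem_rows hR hf)
  rw [rowFun, LinearMap.sum_apply, Finset.sum_eq_single e]
  · rw [if_pos he, LinearMap.smul_apply, utEntry_utE (hlt e he), if_pos rfl, smul_eq_mul, mul_one]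
  · intro f _ hf
    split_ifs with hfR
    · rw [LinearMap.smul_apply, utEntry_utE (hlt f hfR), if_neg hf, smul_zero]
    · rfl
  · simp

lemma rowFun_utE_of_notMem {R : Set (Fin n × Fin n)} (hR : R ∈ t.S.rows) {e : Fin n × Fin n}
    (he : e ∉ R) : t.rowFun R (utE F e) = 0 := by
  refine t.rowFun_eq_zero fun f hf => ?_
  rw [utEntry_utE (t.S.nu_lt (TightSplice.subset_nu_of_mem_rows hR hf)), if_neg]
  rintro rfl
  exact he hf

lemma rowFun_eq_zero_of_mem_D {R : Set (Fin n × Fin n)} (hR : R ∈ t.S.rows) {x : ut n F}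
    (hx : x ∈ t.D) : t.rowFun R x = 0 := by
  suffices h : t.D ≤ LinearMap.ker (t.rowFun R) from h hx
  rw [D_le_iff]
  constructor
  · intro e he h1 h2
    exact t.rowFun_utE_of_notMem hR fun h => h2 (TightSplice.subset_nu_of_mem_rows hR h)
  · intro b
    rw [LinearMap.mem_ker, map_sub, map_smul]
    by_cases h : t.S.rowSrc b ∈ R
    · rw [t.rowFun_utE hR h, t.rowFun_utE hR ((TightSplice.rowSrc_mem_iff hR b).mp h),
        smul_eq_mul, t.rowWeight_tgt hR b h, sub_self]
    · rw [t.rowFun_utE_of_notMem hR h, t.rowFun_utE_of_notMem hR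
        (fun h' => h ((TightSplice.rowSrc_mem_iff hR b).mpr h')), smul_zero, sub_zero]

lemma rowFun_comb (R : t.S.rows) (f : t.S.CR → F) :
    ∃ c : F, c ≠ 0 ∧ t.rowFun R.1 (t.comb f) = f (Sum.inr R) * c := by
  classical
  obtain ⟨e, he, h⟩ := exists_bRow_eq (F := F) R.2
  refine ⟨t.rowWeight R.1 e, t.rowWeight_ne_zero _ _, ?_⟩
  rw [comb_apply, map_sum, Finset.sum_eq_single (Sum.inr R)]
  · rw [map_smul, smul_eq_mul]
    congr 1
    change t.rowFun R.1 (bRow R.1) = _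
    rw [h, t.rowFun_utE R.2 he]
  · rintro (C | R') _ hne
    · rw [map_smul, smul_eq_mul]
      convert mul_zero _
      refine t.rowFun_eq_zero fun e' he' => ?_
      have hnu := TightSplice.subset_nu_of_mem_rows R.2 he'
      exact (t.utEntry_bCol (t.S.nu_lt hnu)).trans (if_neg fun hc =>
        t.S.notMem_nu (TightSplice.subset_lam_of_mem_cols C.2 hc) hnu)
    · rw [map_smul, smul_eq_mul]
      convert mul_zero _
      obtain ⟨e', he', h'⟩ := exists_bRow_eq (F := F) R'.2
      change t.rowFun R.1 (bRow R'.1) = 0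
      rw [h']
      refine t.rowFun_utE_of_notMem R.2 fun hc => hne ?_
      exact congrArg Sum.inr (Subtype.ext (TightSplice.rows_eq R'.2 R.2 he' hc))
  · simp

/-- The `b_x` are independent modulo `D`: column coefficients show up as entries on `λ`, where `D`
is zero, and row coefficients are detected by the functionals `rowFun`, which also vanish on `D`. -/
lemma comb_mem_D_iff {f : t.S.CR → F} : t.comb f ∈ t.D ↔ f = 0 := by
  refine ⟨fun h => ?_, fun h => by rw [h, map_zero]; exact zero_mem _⟩
  ext (C | R)
  · obtain ⟨e, he⟩ := TightSplice.nonempty_of_mem_cols C.2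
    have h1 : utEntry F e (t.comb f) = 0 := t.D_le_utSupp h e fun hc =>
      hc.2 (TightSplice.subset_lam_of_mem_cols C.2 he)
    rw [t.utEntry_comb he] at h1
    exact (mul_eq_zero.mp h1).resolve_right (t.colWeight_ne_zero _ _)
  · obtain ⟨c, hc, h1⟩ := t.rowFun_comb R f
    rw [t.rowFun_eq_zero_of_mem_D R.2 h] at h1
    exact (mul_eq_zero.mp h1.symm).resolve_right hc

lemma utE_mem_iff_of_rows {P : Submodule F (ut n F)} (hP : t.D ≤ P) {e f : Fin n × Fin n}
    (h : EqvGen t.S.rowStep e f) : utE F e ∈ P ↔ utE F f ∈ P := by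
  induction h with
  | rel a b h =>
    obtain ⟨b, rfl, rfl⟩ := (t.S.rowStep_iff _ _).mp h
    have h1 := hP (t.utE_sub_mem_D b)
    constructor
    · intro h2
      have h3 := P.sub_mem h2 h1
      rw [sub_sub_cancel] at h3
      exact (P.smul_mem_iff (t.sig b).ne_zero).mp h3
    · intro h2
      have h3 := P.add_mem h1 (P.smul_mem (t.sig b : F) h2)
      rwa [sub_add_cancel] at h3
  | refl => rfl
  | symm _ _ _ ih => exact ih.symm
  | trans _ _ _ _ _ ih1 ih2 => exact ih1.trans ih2

end IdealDatum

/-! ### Subspaces between `D` and the hull are ideals -/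

namespace IdealDatum

open Relation

variable {n : ℕ} {ord : ∀ S : TightSplice n, LinearOrder S.CR} {F : Type*} [Field F]
  (t : IdealDatum ord F)

lemma utE_mem_sup {e : Fin n × Fin n} (he : e ∈ upSet t.S.lam 0) (hn : e ∉ t.S.lam) :
    utE F e ∈ LinearMap.range t.comb ⊔ t.D := by
  classical
  by_cases hnu : e ∈ t.S.nu
  · obtain ⟨R, hR, heR⟩ := TightSplice.exists_mem_rows hnu
    obtain ⟨f, hf, h⟩ := exists_bRow_eq (F := F) hR
    rw [t.utE_mem_iff_of_rows le_sup_right (TightSplice.eqvGen_of_mem_rows hR _ heR _ hf), ← h]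
    exact Submodule.mem_sup_left ⟨Pi.single (Sum.inr ⟨R, hR⟩) 1, t.comb_single _⟩
  · exact Submodule.mem_sup_right (t.utE_mem_D he hn hnu)

/-- For `x` in the hull, the ratio of an entry to its column weight is constant on each column, so a
combination of the `b_C` removes all entries on `λ`. What remains is a sum of matrix units, each in
`D` or equivalent modulo `D` to a multiple of some `b_R`. -/
lemma hull_le : t.hull ≤ LinearMap.range t.comb ⊔ t.D := by
  classical
  intro x hx
  have hne : ∀ C : t.S.cols, ∃ e, e ∈ C.1 := fun C => TightSplice.nonempty_of_mem_cols C.2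
  choose g hg using hne
  let f : t.S.CR → F :=
    Sum.elim (fun C => utEntry F (g C) x / t.colWeight C.1 (g C)) (fun _ => 0)
  -- The ratio is extended by zero off `C`, since the intermediate elements of an `EqvGen`
  -- derivation are not known to lie in `C`.
  have hstep : ∀ C ∈ t.S.cols, ∀ e f, EqvGen t.S.colStep e f →
      (if e ∈ C then utEntry F e x / t.colWeight C e else 0) =
      (if f ∈ C then utEntry F f x / t.colWeight C f else 0) := by
    intro C hC e f h
    induction h with
    | rel a b h =>
      obtain ⟨b, rfl, rfl⟩ := (t.S.colStep_iff _ _).mp h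
      by_cases hb : t.S.colSrc b ∈ C
      · rw [if_pos hb, if_pos ((TightSplice.colSrc_mem_iff hC b).mp hb), hx.2,
          t.colWeight_tgt hC b hb, mul_div_mul_left _ _ (t.sig b).ne_zero]
      · rw [if_neg hb, if_neg fun h => hb ((TightSplice.colSrc_mem_iff hC b).mpr h)]
    | refl => rfl
    | symm _ _ _ ih => exact ih.symm
    | trans _ _ _ _ _ ih1 ih2 => exact ih1.trans ih2
  have hdiff : x - t.comb f ∈ LinearMap.range t.comb ⊔ t.D := by
    refine mem_of_utE_mem fun i j hij h0 => t.utE_mem_sup ?_ ?_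
    · exact mem_of_mem_utSupp (e := (i, j)) (sub_mem hx.1 (t.comb_mem_hull f).1) h0
    · intro hl
      apply h0
      obtain ⟨C, hC, he⟩ := TightSplice.exists_mem_cols hl
      change utEntry F (i, j) (x - t.comb f) = 0
      have h1 := hstep C hC _ _ (TightSplice.eqvGen_of_mem_cols hC _ (hg ⟨C, hC⟩) _ he)
      rw [if_pos (hg ⟨C, hC⟩), if_pos he] at h1
      rw [map_sub, t.utEntry_comb (C := ⟨C, hC⟩) he]
      change _ - utEntry F (g ⟨C, hC⟩) x / t.colWeight C (g ⟨C, hC⟩) * _ = _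
      rw [h1, div_mul_cancel₀ _ (t.colWeight_ne_zero _ _), sub_self]
  have := add_mem hdiff (show t.comb f ∈ LinearMap.range t.comb ⊔ t.D from
    Submodule.mem_sup_left ⟨f, rfl⟩)
  rwa [sub_add_cancel] at this

/-- With a binding at `(j, k)`, the bracket formula and `x_{kl} = σ x_{ij}` give `x_{ij} (e_{ik} - σ
e_{jl})`. Without one, (S2) says that neither `(i, k)` nor `(j, l)` is vertical, so both matrix
units lie in `D` separately. -/
lemma lie_mem_D {x : ut n F} (hx : x ∈ t.hull) (a : ut n F) : ⁅x, a⁆ ∈ t.D := by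
  suffices h : a ∈ t.D.comap (LieAlgebra.ad F (ut n F) x) from h
  refine mem_of_utE_mem fun j k hjk _ => ?_
  change ⁅x, utE F (j, k)⁆ ∈ t.D
  rw [lie_utE x hjk]
  have hlam := t.S.lam_nonnesting
  have hQ : ∀ f ∈ upSet t.S.lam 2, utE F f ∈ t.D := fun f hf =>
    t.utE_mem_D_of_mem_upSet_two hf
  by_cases h : ∃ i, (i, k) ∈ t.S.nu ∧ (i, j) ∈ t.S.lam
  · obtain ⟨l, hkl, hjl⟩ := (t.S.splice_two j k hjk).mp h
    obtain ⟨i, hik, hij⟩ := h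
    let b : t.S.bind := ⟨(i, j, k, l), hij, hkl, hik, hjl, hjk⟩
    have h1 := hlam.colShift_sub_mem hQ hx.1 hjk hij
    have h2 := hlam.rowShift_sub_mem hQ hx.1 hjk hkl
    have h3 : x.1 k l = (t.sig b : F) * x.1 i j := hx.2 b
    have h4 : utE F (i, k) - (t.sig b : F) • utE F (j, l) ∈ t.D := t.utE_sub_mem_D b
    have h5 := add_mem (sub_mem h1 h2) (t.D.smul_mem (x.1 i j) h4)
    convert h5 using 1
    rw [h3, smul_sub, smul_smul, mul_comm (x.1 i j)]
    abel
  · have h' := h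
    rw [t.S.splice_two j k hjk] at h'
    refine sub_mem (hlam.colShift_mem hQ hx.1 hjk fun i hij => ?_)
      (hlam.rowShift_mem hQ hx.1 hjk fun l hkl => ?_)
    · have h1 := hlam.col_mem_upSet_one hjk hij
      exact t.utE_mem_D (upSet_anti zero_le_one h1)
        (fun hl => hlam.notMem_upSet hl one_pos h1) (fun hn => h ⟨i, hn, hij⟩)
    · have h1 := hlam.row_mem_upSet_one hjk hkl
      exact t.utE_mem_D (upSet_anti zero_le_one h1)
        (fun hl => hlam.notMem_upSet hl one_pos h1) (fun hn => h' ⟨l, hkl, hn⟩)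

/-- The row space of the matroid of a datum. -/
def matroidSpace : Submodule F (t.S.CR → F) :=
  letI := ord t.S
  t.M.rowSpace fun u => u.isLeft = true

lemma toSubspace_eq : t.toSubspace = t.matroidSpace.map t.comb ⊔ t.D := by
  classical
  let := ord t.S
  rw [toSubspace, matroidSpace, LabeledMatroid.rowSpace, Submodule.map_span, ← Set.image_comp]
  congr 2
  refine Set.image_congr fun u _ => ?_
  rw [gen, Function.comp_apply, LabeledMatroid.row, map_add, t.comb_single]
  congr 1
  rw [comb_apply]
  refine Finset.sum_congr rfl fun v _ => ?_
  rw [LabeledMatroid.coeff]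
  split_ifs <;> simp

lemma D_le_toSubspace : t.D ≤ t.toSubspace := le_sup_right

lemma toSubspace_le_hull : t.toSubspace ≤ t.hull := by
  rw [toSubspace_eq]
  refine sup_le ?_ t.D_le_hull
  rintro _ ⟨f, _, rfl⟩
  exact t.comb_mem_hull f

/-- Holds because `comb` is injective modulo `D`; it recovers the matroid's row space from the
ideal. -/
lemma comap_comb_toSubspace : t.toSubspace.comap t.comb = t.matroidSpace := by
  rw [toSubspace_eq]
  ext f
  constructor
  · intro hf
    obtain ⟨_, ⟨g, hg, rfl⟩, d, hd, h⟩ := Submodule.mem_sup.mp hf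
    have h1 : t.comb (f - g) ∈ t.D := by
      rw [map_sub, ← h, add_sub_cancel_left]; exact hd
    rw [t.comb_mem_D_iff, sub_eq_zero] at h1
    rw [h1]; exact hg
  · exact fun hf => Submodule.mem_sup_left ⟨f, hf, rfl⟩

/-- The Lie ideal attached to a datum. -/
def toIdeal : LieIdeal F (ut n F) where
  toSubmodule := t.toSubspace
  lie_mem {a x} hx := by
    have := t.D_le_toSubspace (t.lie_mem_D (t.toSubspace_le_hull hx) a)
    rw [← lie_skew]
    exact neg_mem this

lemma exists_entry_ne_zero {e : Fin n × Fin n} (he : e ∈ t.S.lam) :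
    ∃ x ∈ t.toSubspace, utEntry F e x ≠ 0 := by
  let := ord t.S
  obtain ⟨C, hC, heC⟩ := TightSplice.exists_mem_cols he
  obtain ⟨f, hf, hfC⟩ := t.M.exists_apply_ne_zero (fun u => u.isLeft = true)
    (u := Sum.inl ⟨C, hC⟩) rfl
  refine ⟨t.comb f, ?_, ?_⟩
  · rw [toSubspace_eq]
    exact Submodule.mem_sup_left ⟨f, hf, rfl⟩
  · rw [t.utEntry_comb (C := ⟨C, hC⟩) heC]
    exact mul_ne_zero hfC (t.colWeight_ne_zero _ _)

lemma utE_notMem {e : Fin n × Fin n} (he : e ∈ t.S.nu) : utE F e ∉ t.toSubspace := by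
  classical
  let := ord t.S
  obtain ⟨R, hR, heR⟩ := TightSplice.exists_mem_rows he
  obtain ⟨f, hf, h⟩ := exists_bRow_eq (F := F) hR
  rw [t.utE_mem_iff_of_rows t.D_le_toSubspace (TightSplice.eqvGen_of_mem_rows hR _ heR _ hf), ← h]
  intro hc
  have h1 : Pi.single (Sum.inr ⟨R, hR⟩) 1 ∈ t.toSubspace.comap t.comb := by
    rw [Submodule.mem_comap, t.comb_single]
    exact hc
  rw [comap_comb_toSubspace] at h1
  have := t.M.single_notMem (fun u => u.isLeft = true) (u := Sum.inr ⟨R, hR⟩) (by simp)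
  apply this
  convert h1
  rfl

end IdealDatum

/-- The minimal edges of the support of a subspace. -/
def minSupport {n : ℕ} {F : Type*} [Field F] (I : Set (ut n F)) : Set (Fin n × Fin n) :=
  {e | (∃ x ∈ I, x.1 e.1 e.2 ≠ 0) ∧ ∀ f, leE f e → f ≠ e → ∀ x ∈ I, x.1 f.1 f.2 = 0}

/-! ### Recovering the datum from its subspace -/

namespace IdealDatum

variable {n : ℕ} {ord : ∀ S : TightSplice n, LinearOrder S.CR} {F : Type*} [Field F]
  (t : IdealDatum ord F)

lemma lam_eq_minSupport : t.S.lam = minSupport (t.toSubspace : Set (ut n F)) := by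
  ext e
  constructor
  · intro he
    refine ⟨t.exists_entry_ne_zero he, fun f hfe hne x hx => ?_⟩
    by_contra h0
    obtain ⟨_, g, hg, h1, _⟩ := mem_of_mem_utSupp (t.toSubspace_le_hull hx).1 h0
    have hge := t.S.lam_nonnesting.eq_of_le hg he (hfe.1.trans h1.1) (h1.2.trans hfe.2)
    subst hge
    exact hne (Prod.ext (le_antisymm h1.1 hfe.1) (le_antisymm hfe.2 h1.2))
  · rintro ⟨⟨x, hx, h0⟩, hmin⟩
    obtain ⟨_, g, hg, h1, _⟩ := mem_of_mem_utSupp (t.toSubspace_le_hull hx).1 h0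
    by_cases hge : g = e
    · exact hge ▸ hg
    · obtain ⟨y, hy, hy0⟩ := t.exists_entry_ne_zero hg
      exact absurd (hmin g h1 hge y hy) hy0

lemma nu_eq : t.S.nu = {e | e ∈ upSet t.S.lam 0 ∧ e ∉ t.S.lam ∧ utE F e ∉ t.toSubspace} := by
  ext e
  constructor
  · exact fun he => ⟨t.S.nu_subset_upSet he, fun h => t.S.notMem_nu h he, t.utE_notMem he⟩
  · rintro ⟨h1, h2, h3⟩
    by_contra h4
    exact h3 (t.D_le_toSubspace (t.utE_mem_D h1 h2 h4))

lemma toSubspace_injective :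
    Function.Injective (toSubspace : IdealDatum ord F → Submodule F (ut n F)) := by
  intro t t' h
  have hS : t.S = t'.S := by
    have hlam : t.S.lam = t'.S.lam := by
      rw [lam_eq_minSupport, lam_eq_minSupport, h]
    refine TightSplice.ext hlam ?_
    rw [nu_eq, nu_eq, hlam, h]
  -- Any element with nonzero entry at the source of a binding determines its label as a ratio of
  -- two entries.
  have hsig : ∀ b b', b.1 = b'.1 → t.sig b = t'.sig b' := by
    rintro ⟨b, hb⟩ ⟨b', hb'⟩ hbb
    simp only at hbb
    subst hbb
    obtain ⟨x, hx, h0⟩ := t.exists_entry_ne_zero (t.S.colSrc_mem ⟨b, hb⟩)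
    have h1 := (t.toSubspace_le_hull hx).2 ⟨b, hb⟩
    rw [h] at hx
    have h2 := (t'.toSubspace_le_hull hx).2 ⟨b, hb'⟩
    have h3 := h1.symm.trans h2
    exact Units.ext (mul_right_cancel₀ h0 h3)
  -- The two row spaces live over index types depending on the splices, hence the heterogeneous
  -- equality.
  have hP : HEq t.matroidSpace t'.matroidSpace := by
    rw [← comap_comb_toSubspace, ← comap_comb_toSubspace, h]
    obtain ⟨S, sig, M⟩ := t
    obtain ⟨S', sig', M'⟩ := t'
    simp only at hS
    subst hS
    obtain rfl : sig = sig' := funext fun b => hsig b b rfl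
    rfl
  obtain ⟨S, sig, M⟩ := t
  obtain ⟨S', sig', M'⟩ := t'
  simp only at hS
  subst hS
  obtain rfl : sig = sig' := funext fun b => hsig b b rfl
  classical
  let := ord S
  have hfin : Fintype S.CR := Fintype.ofFinite _
  obtain rfl : M = M' := LabeledMatroid.eq_of_rowSpace_eq (eq_of_heq hP)
  rfl

end IdealDatum

/-! ### Sets closed under corrected commutators -/

section CommClosed

variable {n : ℕ} {F : Type*} [Field F]

/-- The associative product of two strictly upper triangular matrices. -/
def utMul (x y : ut n F) : ut n F :=
  ⟨x.1 * y.1, fun i j h => by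
    rw [Matrix.mul_apply]
    refine Finset.sum_eq_zero fun k _ => ?_
    rcases le_total k i with hk | hk
    · rw [ut_apply_eq_zero x hk, zero_mul]
    · rw [ut_apply_eq_zero y (h.trans hk), mul_zero]⟩

lemma utMul_apply (x y : ut n F) (i j : Fin n) :
    (utMul x y).1 i j = ∑ k, x.1 i k * y.1 k j := Matrix.mul_apply

lemma exists_of_utMul_ne_zero {x y : ut n F} {i j : Fin n} (h : (utMul x y).1 i j ≠ 0) :
    ∃ k, x.1 i k ≠ 0 ∧ y.1 k j ≠ 0 := by
  rw [utMul_apply] at h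
  obtain ⟨k, -, hk⟩ := Finset.exists_ne_zero_of_sum_ne_zero h
  exact ⟨k, left_ne_zero_of_mul hk, right_ne_zero_of_mul hk⟩

lemma lt_of_ut_ne_zero {x : ut n F} {i j : Fin n} (h : x.1 i j ≠ 0) : i < j := by
  by_contra hle
  exact h (ut_apply_eq_zero x (not_lt.mp hle))

lemma mem_utSupp_of {A : Set (Fin n × Fin n)} {x : ut n F}
    (h : ∀ i j, x.1 i j ≠ 0 → (i, j) ∈ A) : x ∈ utSupp F A := by
  intro e he
  by_contra h0
  exact he (h _ _ h0)

/-- Multiplying by `1 + v` on the right changes an entry only by multiples of entries to its left in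
the same row. -/
lemma add_utMul_apply {x v : ut n F} {r s : Fin n} (h : ∀ t < s, x.1 r t = 0) :
    (x + utMul x v).1 r s = x.1 r s := by
  change x.1 r s + (utMul x v).1 r s = _
  rw [add_eq_left]
  by_contra h0
  obtain ⟨t, h1, h2⟩ := exists_of_utMul_ne_zero h0
  exact h1 (h t (lt_of_ut_ne_zero h2))

lemma utMul_right_mem {lam : Set (Fin n × Fin n)} {l : ℕ} {x : ut n F}
    (hx : x ∈ utSupp F (upSet lam l)) (y : ut n F) :
    utMul x y ∈ utSupp F (upSet lam (l + 1)) := by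
  refine mem_utSupp_of fun i j h => ?_
  obtain ⟨k, h1, h2⟩ := exists_of_utMul_ne_zero h
  have h3 := mem_of_mem_utSupp hx (e := (i, k)) h1
  have h4 := lt_of_ut_ne_zero h1
  have h5 := lt_of_ut_ne_zero h2
  exact upSet_add h3 le_rfl h5.le (by simp only; omega)

lemma utMul_left_mem {lam : Set (Fin n × Fin n)} {l : ℕ} {x : ut n F}
    (hx : x ∈ utSupp F (upSet lam l)) (y : ut n F) :
    utMul y x ∈ utSupp F (upSet lam (l + 1)) := by
  refine mem_utSupp_of fun i j h => ?_
  obtain ⟨k, h1, h2⟩ := exists_of_utMul_ne_zero h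
  have h3 := mem_of_mem_utSupp hx (e := (k, j)) h2
  have h4 := lt_of_ut_ne_zero h1
  have h5 := lt_of_ut_ne_zero h2
  exact upSet_add h3 h4.le le_rfl (by simp only; omega)

lemma lie_eq_utMul (x y : ut n F) : ⁅x, y⁆ = utMul x y - utMul y x :=
  Subtype.ext (ut_coe_lie x y)

lemma lie_mem_upSet {lam : Set (Fin n × Fin n)} {l : ℕ} {x : ut n F}
    (hx : x ∈ utSupp F (upSet lam l)) (y : ut n F) :
    ⁅x, y⁆ ∈ utSupp F (upSet lam (l + 1)) := by
  rw [lie_eq_utMul]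
  exact sub_mem (utMul_right_mem hx y) (utMul_left_mem hx y)

lemma minSupport_nonnesting (X : Set (ut n F)) : IsNonnesting (minSupport X) := by
  have key : ∀ e ∈ minSupport X, ∀ f ∈ minSupport X, e ≠ f → ¬ leE e f := by
    rintro e ⟨⟨x, hx, h0⟩, _⟩ f ⟨_, hf⟩ hne hle
    exact h0 (hf e hle hne x hx)
  refine ⟨⟨?_, ?_, ?_⟩, fun e he f hf hne => key e he f hf hne⟩
  · rintro e ⟨⟨x, _, h0⟩, _⟩
    exact lt_of_ut_ne_zero h0
  · exact fun e he f hf hne h => key e he f hf hne ⟨h.1, h.2.le⟩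
  · exact fun e he f hf hne h => key e he f hf hne ⟨h.1.ge, h.2⟩

lemma subset_utSupp_minSupport (X : Set (ut n F)) :
    X ⊆ utSupp F (upSet (minSupport X) 0) := by
  intro x hx
  refine mem_utSupp_of fun i j hij => ?_
  let T : Set (Fin n × Fin n) := {f | leE f (i, j) ∧ ∃ y ∈ X, y.1 f.1 f.2 ≠ 0}
  obtain ⟨f, ⟨hf1, hf2⟩, hmin⟩ := Set.exists_min_image T edgeHt (Set.toFinite T)
    ⟨(i, j), ⟨le_rfl, le_rfl⟩, x, hx, hij⟩
  have hflt : f.1 < f.2 := by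
    obtain ⟨y, _, hy⟩ := hf2
    exact lt_of_ut_ne_zero hy
  have hf1' : i ≤ f.1 ∧ f.2 ≤ j := hf1
  refine ⟨lt_of_ut_ne_zero hij, f, ⟨hf2, fun g hg hne y hy => ?_⟩, hf1, ?_⟩
  · by_contra h0
    have hg' : f.1 ≤ g.1 ∧ g.2 ≤ f.2 := hg
    have h1 := hmin g ⟨⟨hf1.1.trans hg.1, hg.2.trans hf1.2⟩, y, hy, h0⟩
    have h2 := lt_of_ut_ne_zero h0
    unfold edgeHt at h1
    refine hne (Prod.ext (Fin.ext ?_) (Fin.ext ?_)) <;> omega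
  · unfold edgeHt
    simp only
    omega

/-- An upper set of edges for `⪯`. -/
def IsUpperEdges (A : Set (Fin n × Fin n)) : Prop := ∀ e ∈ A, ∀ f, leE e f → f ∈ A

lemma isUpperEdges_upSet (lam : Set (Fin n × Fin n)) (l : ℕ) : IsUpperEdges (upSet lam l) := by
  rintro e ⟨h1, g, hg, h2, h3⟩ f h
  have h1' : e.1 < e.2 := h1
  have h' : f.1 ≤ e.1 ∧ e.2 ≤ f.2 := h
  unfold edgeHt at h3
  exact ⟨h.1.trans_lt (h1'.trans_le h.2), g, hg, ⟨h.1.trans h2.1, h2.2.trans h.2⟩,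
    by unfold edgeHt; omega⟩

/-- The closure properties shared by Lie ideals and by the sets `N - 1` for normal subgroups `N` of
the unitriangular group over a prime field. -/
structure IsCommClosed (X : Set (ut n F)) : Prop where
  zero_mem : 0 ∈ X
  lie_mem : ∀ x ∈ X, ∀ a, ∃ v, ⁅x, a⁆ + utMul ⁅x, a⁆ v ∈ X
  add_mem : ∀ A, IsUpperEdges A → (utSupp F A : Set (ut n F)) ⊆ X →
    ∀ x ∈ X, ∀ m ∈ utSupp F A, x + m ∈ X
  smul_mem : ∀ w (c : F), c ≠ 0 → c • utE F w ∈ X → ∀ d : F, d • utE F w ∈ X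

/-- The matrix `y` has a nonzero entry `(h, k)` at the lower left corner of its support. -/
def HasCorner (y : ut n F) (h k : Fin n) : Prop :=
  (∀ r s, y.1 r s ≠ 0 → r ≤ h ∧ k ≤ s) ∧ y.1 h k ≠ 0

lemma HasCorner.add_utMul {y : ut n F} {h k : Fin n} (hy : HasCorner y h k) (v : ut n F) :
    HasCorner (y + utMul y v) h k := by
  constructor
  · intro r s hrs
    by_cases h0 : y.1 r s = 0
    · have h1 : (utMul y v).1 r s ≠ 0 := by
        intro h1
        apply hrs
        change y.1 r s + (utMul y v).1 r s = 0
        rw [h0, h1, add_zero]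
      obtain ⟨t, ht, ht'⟩ := exists_of_utMul_ne_zero h1
      have := hy.1 r t ht
      exact ⟨this.1, this.2.trans (lt_of_ut_ne_zero ht').le⟩
    · exact hy.1 r s h0
  · rw [add_utMul_apply]
    · exact hy.2
    · intro t ht
      by_contra h0
      exact (hy.1 h t h0).2.not_gt ht

lemma lie_utE_apply (x : ut n F) {j k r s : Fin n} (hjk : j < k) (hrs : r < s) :
    (⁅x, utE F (j, k)⁆ : ut n F).1 r s =
      (if s = k then x.1 r j else 0) - if r = j then x.1 k s else 0 := by
  rw [lie_utE x hjk]
  change (colShift x j k).1 r s - (rowShift x j k).1 r s = _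
  rw [colShift, rowShift, utMk_apply, utMk_apply, if_pos hrs, if_pos hrs]

lemma lie_utE_eq_zero (x : ut n F) {j k r s : Fin n} (hjk : j < k) (h : s < k) :
    (⁅x, utE F (j, k)⁆ : ut n F).1 r s = 0 := by
  rcases lt_or_ge r s with hrs | hrs
  · rw [lie_utE_apply x hjk hrs, if_neg h.ne, ut_apply_eq_zero x h.le]
    simp
  · exact ut_apply_eq_zero _ hrs

namespace IsCommClosed

variable {X : Set (ut n F)} (hX : IsCommClosed X)
include hX

/-- Start from `x` in `X` with nonzero entry at a minimal edge `(i, j)` below `(h, k)`. Two brackets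
with matrix units carry this entry to `(h, k)`; the second one isolates a single row or column, and
minimality of `(i, j)` kills whatever would lie beyond the corner. -/
lemma exists_isCorner {h k : Fin n} (hw : (h, k) ∈ upSet (minSupport X) 2) :
    ∃ y ∈ X, HasCorner y h k := by
  obtain ⟨hhk, ⟨i, j⟩, ⟨⟨x, hx, hne⟩, hmin⟩, h1, h2⟩ := hw
  unfold edgeHt at h2
  obtain ⟨hhi, hjk⟩ := h1
  simp only at hhi hjk h2 hne
  have hhk' : h < k := hhk
  have hij := lt_of_ut_ne_zero hne
  -- It is enough to find an iterated bracket with a corner.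
  suffices hs : ∃ a, ∀ v, ∃ b, HasCorner ⁅⁅x, a⁆ + utMul ⁅x, a⁆ v, b⁆ h k by
    obtain ⟨a, ha⟩ := hs
    obtain ⟨v, hv⟩ := hX.lie_mem x hx a
    obtain ⟨b, hb⟩ := ha v
    obtain ⟨v', hv'⟩ := hX.lie_mem _ hv b
    exact ⟨_, hv', hb.add_utMul v'⟩
  rcases eq_or_lt_of_le hhi with rfl | hhi
  · -- `h = i`
    -- Excess height two leaves room for `m` strictly between `j` and `k`. Column `j` is moved to
    -- `m` and then to `k`; row `k` of the first result is zero, so the second bracket has no row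
    -- term.
    let m : Fin n := ⟨k - 1, by omega⟩
    have hjm : j < m := by
      rw [Fin.lt_def]; change (j : ℕ) < k - 1; omega
    have hmk : m < k := by
      rw [Fin.lt_def]; change (k : ℕ) - 1 < k; omega
    refine ⟨utE F (j, m), fun v => ⟨utE F (m, k), ?_⟩⟩
    set y := ⁅x, utE F (j, m)⁆ + utMul ⁅x, utE F (j, m)⁆ v with hy
    have hyk : ∀ s, y.1 k s = 0 := by
      have hz : ∀ s, (⁅x, utE F (j, m)⁆ : ut n F).1 k s = 0 := by
        intro s
        rcases lt_or_ge k s with hs | hs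
        · rw [lie_utE_apply x hjm hs, if_neg (hmk.trans hs).ne', if_neg (hjm.trans hmk).ne',
            sub_zero]
        · exact ut_apply_eq_zero _ hs
      intro s
      rw [hy, add_utMul_apply fun t _ => hz t, hz]
    have hym : ∀ r, r < m → y.1 r m = x.1 r j := by
      intro r hr
      rw [hy, add_utMul_apply fun t ht => lie_utE_eq_zero x hjm ht, lie_utE_apply x hjm hr,
        if_pos rfl, ut_apply_eq_zero x (le_refl m)]
      simp
    constructor
    · intro r s hrs
      have hlt := lt_of_ut_ne_zero hrs
      rw [lie_utE_apply _ hmk hlt, hyk, ite_self, sub_zero] at hrs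
      simp only [ne_eq, ite_eq_right_iff, Classical.not_imp] at hrs
      obtain ⟨rfl, hrs⟩ := hrs
      refine ⟨?_, le_rfl⟩
      rw [hym r (lt_of_ut_ne_zero hrs)] at hrs
      by_contra hc
      exact hrs (hmin (r, j) ⟨(not_le.mp hc).le, le_rfl⟩
        (fun he => hc (congrArg Prod.fst he).le) x hx)
    · rw [lie_utE_apply _ hmk hhk', hyk, ite_self, sub_zero, if_pos rfl, hym _ (hij.trans hjm)]
      exact hne
  rcases eq_or_lt_of_le hjk with rfl | hjk
  · -- `k = j`
    -- Mirror image: row `i` is moved to `m` and then to `h`, with `h < m < i`. Column `h` of the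
    -- first result is zero.
    let m : Fin n := ⟨h + 1, by omega⟩
    have hhm : h < m := by
      rw [Fin.lt_def]; change (h : ℕ) < h + 1; omega
    have hmi : m < i := by
      rw [Fin.lt_def]; change (h : ℕ) + 1 < i; omega
    refine ⟨utE F (m, i), fun v => ⟨utE F (h, m), ?_⟩⟩
    set y := ⁅x, utE F (m, i)⁆ + utMul ⁅x, utE F (m, i)⁆ v with hy
    have hyh : ∀ r, y.1 r h = 0 := by
      intro r
      rw [hy, add_utMul_apply fun t ht => lie_utE_eq_zero x hmi (ht.trans (hhm.trans hmi)),
        lie_utE_eq_zero x hmi (hhm.trans hmi)]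
    have hz : ∀ s ≤ j, (⁅x, utE F (m, i)⁆ : ut n F).1 m s = - x.1 i s := by
      intro s hs
      rcases lt_or_ge m s with hms | hms
      · rw [lie_utE_apply x hmi hms, if_pos rfl, ut_apply_eq_zero x (le_refl m), ite_self,
          zero_sub]
      · rw [ut_apply_eq_zero _ hms, ut_apply_eq_zero x (hms.trans hmi.le), neg_zero]
    have hxs : ∀ s < j, x.1 i s = 0 := fun s hs => hmin (i, s) ⟨le_rfl, hs.le⟩
      (fun he => hs.ne (congrArg Prod.snd he)) x hx
    have hym : ∀ s ≤ j, y.1 m s = - x.1 i s := by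
      intro s hs
      rw [hy, add_utMul_apply, hz s hs]
      intro t ht
      rw [hz t (ht.le.trans hs), hxs t (ht.trans_le hs), neg_zero]
    constructor
    · intro r s hrs
      have hlt := lt_of_ut_ne_zero hrs
      rw [lie_utE_apply _ hhm hlt, hyh, ite_self, zero_sub, neg_ne_zero] at hrs
      simp only [ne_eq, ite_eq_right_iff, Classical.not_imp] at hrs
      obtain ⟨rfl, hrs⟩ := hrs
      refine ⟨le_rfl, ?_⟩
      by_contra hc
      rw [not_le] at hc
      rw [hym s hc.le, hxs s hc, neg_zero] at hrs
      exact hrs rfl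
    · rw [lie_utE_apply _ hhm hhk', hyh, ite_self, zero_sub, if_pos rfl, hym _ le_rfl, neg_neg]
      exact hne
  · refine ⟨utE F (j, k), fun v => ⟨utE F (h, i), ?_⟩⟩
    set y := ⁅x, utE F (j, k)⁆ + utMul ⁅x, utE F (j, k)⁆ v with hy
    have hyh : ∀ r, ∀ s < k, y.1 r s = 0 := by
      intro r s hs
      rw [hy, add_utMul_apply fun t ht => lie_utE_eq_zero x hjk (ht.trans hs),
        lie_utE_eq_zero x hjk hs]
    have hyk : y.1 i k = x.1 i j := by
      rw [hy, add_utMul_apply fun t ht => lie_utE_eq_zero x hjk ht,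
        lie_utE_apply x hjk (hij.trans hjk), if_pos rfl, if_neg hij.ne, sub_zero]
    constructor
    · intro r s hrs
      have hlt := lt_of_ut_ne_zero hrs
      rw [lie_utE_apply _ hhi hlt, hyh _ _ hhk', ite_self, zero_sub, neg_ne_zero] at hrs
      simp only [ne_eq, ite_eq_right_iff, Classical.not_imp] at hrs
      obtain ⟨rfl, hrs⟩ := hrs
      refine ⟨le_rfl, ?_⟩
      by_contra hc
      exact hrs (hyh _ _ (not_le.mp hc))
    · rw [lie_utE_apply _ hhi hhk', hyh _ _ hhk', ite_self, zero_sub, if_pos rfl, hyk, neg_ne_zero]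
      exact hne

/-- Entries in `A` can be added and removed freely, so `x` may be replaced by a multiple of `e_w`,
which is then rescaled and completed to any matrix supported in `insert w A`. -/
lemma utSupp_insert_subset {A : Set (Fin n × Fin n)} (hA : IsUpperEdges A)
    (hAX : (utSupp F A : Set (ut n F)) ⊆ X) {w : Fin n × Fin n} {x : ut n F} (hx : x ∈ X)
    (hxA : x ∈ utSupp F (insert w A)) (hxw : x.1 w.1 w.2 ≠ 0) :
    (utSupp F (insert w A) : Set (ut n F)) ⊆ X := by
  have hw : w.1 < w.2 := lt_of_ut_ne_zero hxw
  have hsub : ∀ y ∈ utSupp F (insert w A), y - y.1 w.1 w.2 • utE F w ∈ utSupp F A := by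
    intro y hy e he
    change y.1 e.1 e.2 - y.1 w.1 w.2 * (utE F w).1 e.1 e.2 = 0
    rw [utE_apply]
    by_cases hew : e = w
    · subst hew; simp [hw]
    · have h0 : y.1 e.1 e.2 = 0 := hy e fun h => (Set.mem_insert_iff.mp h).elim hew he
      simp [h0, hew]
  have h1 : x.1 w.1 w.2 • utE F w ∈ X := by
    have := hX.add_mem A hA hAX x hx _ (neg_mem (hsub x hxA))
    rwa [neg_sub, add_sub_cancel] at this
  intro y hy
  have := hX.add_mem A hA hAX _ (hX.smul_mem w _ hxw h1 (y.1 w.1 w.2)) _ (hsub y hy)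
  rwa [add_sub_cancel] at this

/-- Take a maximal upper set `A` of `upSet (minSupport X) 2` over which everything lies in `X`. For
an edge `w` of maximal height left out, all edges strictly above `w` are in `A`, so an element with
corner `w` would enlarge `A`. -/
lemma utSupp_upSet_two_subset : (utSupp F (upSet (minSupport X) 2) : Set (ut n F)) ⊆ X := by
  let T : Set (Set (Fin n × Fin n)) := {A | IsUpperEdges A ∧
    (utSupp F A : Set (ut n F)) ⊆ X ∧ A ⊆ upSet (minSupport X) 2}
  have hT : T.Nonempty := by
    refine ⟨∅, fun e he => he.elim, fun x hx => ?_, Set.empty_subset _⟩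
    have : x = 0 := ut_ext fun i j _ => hx (i, j) (Set.notMem_empty _)
    rw [this]; exact hX.zero_mem
  obtain ⟨A, ⟨hA, hAX, hAsub⟩, hmax⟩ := (Set.toFinite T).exists_maximal hT
  suffices h : upSet (minSupport X) 2 ⊆ A from fun x hx => hAX fun e he => hx e fun h' => he (h h')
  intro w0 hw0
  by_contra hw0A
  obtain ⟨w, ⟨hw, hwA⟩, hwmax⟩ := Set.exists_max_image (upSet (minSupport X) 2 \ A) edgeHt
    (Set.toFinite _) ⟨w0, hw0, hw0A⟩
  have hwlt : w.1 < w.2 := hw.1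
  have hup : ∀ f, leE w f → f ∈ insert w A := by
    intro f hf
    by_contra hfA
    have hf2 := isUpperEdges_upSet _ _ w hw f hf
    have h1 := hwmax f ⟨hf2, fun h => hfA (Or.inr h)⟩
    have hf' : f.1 ≤ w.1 ∧ w.2 ≤ f.2 := hf
    unfold edgeHt at h1
    refine hfA (Or.inl (Prod.ext (Fin.ext ?_) (Fin.ext ?_))) <;> omega
  obtain ⟨y, hy, hy1, hy2⟩ := hX.exists_isCorner (h := w.1) (k := w.2) hw
  have hyA : y ∈ utSupp F (insert w A) := mem_utSupp_of fun r s hrs => hup (r, s) (hy1 r s hrs)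
  have h2 : insert w A ∈ T := by
    refine ⟨?_, hX.utSupp_insert_subset hA hAX hy hyA hy2, Set.insert_subset hw hAsub⟩
    rintro e (rfl | he) f hf
    · exact hup f hf
    · exact Or.inr (hA e he f hf)
  exact hwA (hmax h2 (Set.subset_insert _ _) (Set.mem_insert _ _))

end IsCommClosed

/-- The edges above `lam` of height at least two, together with the compositions of two edges of
`lam` whose first left endpoint is at least `m`. -/
def prodSet (lam : Set (Fin n × Fin n)) (m : ℕ) : Set (Fin n × Fin n) :=
  upSet lam 2 ∪ {e | m ≤ (e.1 : ℕ) ∧ ∃ j, (e.1, j) ∈ lam ∧ (j, e.2) ∈ lam}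

lemma _root_.IsNonnesting.isUpperEdges_prodSet {lam : Set (Fin n × Fin n)} (h : IsNonnesting lam)
    (m : ℕ) : IsUpperEdges (prodSet lam m) := by
  rintro e (he | ⟨hm, j, h1, h2⟩) f hf
  · exact Or.inl (isUpperEdges_upSet _ _ e he f hf)
  · by_cases hef : f = e
    · subst hef; exact Or.inr ⟨hm, j, h1, h2⟩
    · left
      have h3 : (e.1, e.2) ∈ upSet lam 1 := h.col_mem_upSet_one (h.lt h2) h1
      have hlt : e.1 < e.2 := h3.1
      have hf' : f.1 ≤ e.1 ∧ e.2 ≤ f.2 := hf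
      refine upSet_add h3 (m := 1) (g := f) hf.1 hf.2 ?_
      simp only
      by_contra hc
      refine hef (Prod.ext (Fin.ext ?_) (Fin.ext ?_)) <;> omega

lemma _root_.IsNonnesting.utMul_mem_prodSet {lam : Set (Fin n × Fin n)} (h : IsNonnesting lam)
    {x y : ut n F} (hx : x ∈ utSupp F (upSet lam 0)) (hy : y ∈ utSupp F (upSet lam 0)) :
    utMul x y ∈ utSupp F (prodSet lam 0) := by
  refine mem_utSupp_of fun r s hrs => ?_
  obtain ⟨t, h1, h2⟩ := exists_of_utMul_ne_zero hrs
  have h3 := lt_of_ut_ne_zero h1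
  have h4 := lt_of_ut_ne_zero h2
  by_cases h5 : (r, t) ∈ lam
  · by_cases h6 : (t, s) ∈ lam
    · exact Or.inr ⟨Nat.zero_le _, t, h5, h6⟩
    · exact Or.inl (h.row_mem_upSet_two h3 (mem_of_mem_utSupp hy (e := (t, s)) h2) h6)
  · exact Or.inl (h.col_mem_upSet_two h4 (mem_of_mem_utSupp hx (e := (r, t)) h1) h5)

/-! ### Products of two elements are absorbed -/

namespace IsCommClosed

variable {X : Set (ut n F)} (hX : IsCommClosed X)
include hX

/-- Downward induction on the first left endpoint. For edges `(a, j)`, `(j, b)` of `λ`, the bracket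
of `x` with `e_{j,b}` is `x_{aj} e_{ab} - x_{bl} e_{jl}` modulo `upSet λ 2`. The second term,
present if `(b, l)` is in `λ`, is again a composition, starting at `j > a`, so it is already
absorbed. -/
lemma utSupp_prodSet_subset (d m : ℕ) (hd : n ≤ m + d) :
    (utSupp F (prodSet (minSupport X) m) : Set (ut n F)) ⊆ X := by
  have hlam := minSupport_nonnesting X
  induction d generalizing m with
  | zero =>
    intro x hx
    refine hX.utSupp_upSet_two_subset fun e he => hx e ?_
    rintro (h | ⟨h, _⟩)
    · exact he h
    · have := e.1.isLt
      omega
  | succ d ih =>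
    have ih' := ih (m + 1) (by omega)
    have hupper := hlam.isUpperEdges_prodSet (m + 1)
    by_cases hex : ∃ a j b : Fin n, (a : ℕ) = m ∧ (a, j) ∈ minSupport X ∧ (j, b) ∈ minSupport X ∧
        (a, b) ∉ upSet (minSupport X) 2
    · obtain ⟨a, j, b, rfl, haj, hjb, hab⟩ := hex
      -- Endpoints in `λ` are unique, so lowering the bound to `a` adds just one composition. As
      -- `(a, b)` is outside `upSet (minSupport X) 2`, the correction by `v` cannot affect its
      -- entry.
      have hset : prodSet (minSupport X) (a : ℕ) =
          insert (a, b) (prodSet (minSupport X) ((a : ℕ) + 1)) := by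
        ext ⟨r, s⟩
        constructor
        · rintro (h | ⟨hm, t, h1, h2⟩)
          · exact Or.inr (Or.inl h)
          · by_cases hr : r = a
            · subst hr
              obtain rfl := hlam.right_unique haj h1
              obtain rfl := hlam.right_unique hjb h2
              exact Or.inl rfl
            · refine Or.inr (Or.inr ⟨?_, t, h1, h2⟩)
              have : (r : ℕ) ≠ a := fun h => hr (Fin.ext h)
              simp only at hm ⊢
              omega
        · rintro (h | h | ⟨hm, h⟩)
          · obtain ⟨rfl, rfl⟩ := Prod.mk.inj h
            exact Or.inr ⟨le_rfl, j, haj, hjb⟩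
          · exact Or.inl h
          · exact Or.inr ⟨by omega, h⟩
      obtain ⟨x, hx, hne⟩ := haj.1
      simp only at hne
      have hjb' := hlam.lt hjb
      have haj' := hlam.lt haj
      have hx0 := subset_utSupp_minSupport X hx
      obtain ⟨v, hv⟩ := hX.lie_mem x hx (utE F (j, b))
      have hv2 : utMul ⁅x, utE F (j, b)⁆ v ∈ utSupp F (upSet (minSupport X) 2) :=
        utMul_right_mem (lie_mem_upSet hx0 _) v
      rw [hset]
      refine hX.utSupp_insert_subset hupper ih' hv ?_ ?_
      · have hQ : ∀ f ∈ upSet (minSupport X) 2, utE F f ∈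
            utSupp F (insert (a, b) (prodSet (minSupport X) ((a : ℕ) + 1))) := fun f hf =>
          utE_mem_utSupp (Or.inr (Or.inl hf))
        refine AddMemClass.add_mem ?_ (fun e he => hv2 e fun h => he (Or.inr (Or.inl h)))
        rw [lie_utE x hjb']
        refine sub_mem (hlam.colShift_mem hQ hx0 hjb' fun i hi => ?_)
          (hlam.rowShift_mem hQ hx0 hjb' fun l hl => ?_)
        · rw [hlam.left_unique hi haj]
          exact utE_mem_utSupp (Or.inl rfl)
        · exact utE_mem_utSupp (Or.inr (Or.inr ⟨haj', b, hjb, hl⟩))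
      · change (⁅x, utE F (j, b)⁆ : ut n F).1 a b + (utMul ⁅x, utE F (j, b)⁆ v).1 a b ≠ 0
        rw [hv2 (a, b) hab, add_zero, lie_utE_apply x hjb' (haj'.trans hjb'), if_pos rfl,
          if_neg haj'.ne, sub_zero]
        exact hne
    · convert ih' using 2
      congr 1
      ext ⟨r, s⟩
      constructor
      · rintro (h | ⟨hm, t, h1, h2⟩)
        · exact Or.inl h
        · by_cases hr : (r : ℕ) = m
          · by_cases hrs : (r, s) ∈ upSet (minSupport X) 2
            · exact Or.inl hrs
            · exact absurd ⟨r, t, s, hr, h1, h2, hrs⟩ hex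
          · refine Or.inr ⟨?_, t, h1, h2⟩
            simp only at hm ⊢
            omega
      · rintro (h | ⟨hm, h⟩)
        · exact Or.inl h
        · exact Or.inr ⟨by omega, h⟩

lemma add_mem_of_mem_prodSet {x m : ut n F} (hx : x ∈ X)
    (hm : m ∈ utSupp F (prodSet (minSupport X) 0)) : x + m ∈ X :=
  hX.add_mem _ ((minSupport_nonnesting X).isUpperEdges_prodSet 0)
    (hX.utSupp_prodSet_subset n 0 (by omega)) x hx m hm

end IsCommClosed

lemma utMul_mem_prodSet {X : Set (ut n F)} {x y : ut n F} (hx : x ∈ X) (hy : y ∈ X) :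
    utMul x y ∈ utSupp F (prodSet (minSupport X) 0) :=
  (minSupport_nonnesting X).utMul_mem_prodSet (subset_utSupp_minSupport X hx)
    (subset_utSupp_minSupport X hy)

lemma utMul_lie_mem_prodSet {X : Set (ut n F)} {x : ut n F} (hx : x ∈ X) (a v : ut n F) :
    utMul ⁅x, a⁆ v ∈ utSupp F (prodSet (minSupport X) 0) := by
  have h : utMul ⁅x, a⁆ v ∈ utSupp F (upSet (minSupport X) 2) :=
    utMul_right_mem (lie_mem_upSet (subset_utSupp_minSupport X hx) a) v
  exact fun e he => h e fun h' => he (Or.inl h')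

lemma isCommClosed_lieIdeal (I : LieIdeal F (ut n F)) : IsCommClosed (I : Set (ut n F)) where
  zero_mem := zero_mem I
  lie_mem x hx a := by
    refine ⟨0, ?_⟩
    have h0 : utMul ⁅x, a⁆ (0 : ut n F) = 0 := Subtype.ext (mul_zero _)
    rw [h0, add_zero, ← lie_skew]
    exact neg_mem (I.lie_mem hx)
  add_mem A _ hAX x hx m hm := add_mem (S := LieIdeal F (ut n F)) hx (hAX hm)
  smul_mem w c hc h d := by
    have h' : c • utE F w ∈ I.toSubmodule := h
    rw [Submodule.smul_mem_iff _ hc] at h'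
    exact I.toSubmodule.smul_mem d h'

end CommClosed

/-! ### The tight splice of a Lie ideal -/

section IdealSplice

variable {n : ℕ} {F : Type*} [Field F] (I : LieIdeal F (ut n F))

lemma utE_mem_of_mem_upSet_two {f : Fin n × Fin n} (hf : f ∈ upSet (minSupport (I : Set (ut n F))) 2) :
    utE F f ∈ I.toSubmodule :=
  (isCommClosed_lieIdeal I).utSupp_upSet_two_subset (utE_mem_utSupp hf)

lemma lieIdeal_lie_mem_right {x : ut n F} (hx : x ∈ I) (a : ut n F) : ⁅x, a⁆ ∈ I.toSubmodule := by
  rw [← lie_skew]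
  exact neg_mem (I.lie_mem hx)

lemma smul_sub_smul_mem {i j k l : Fin n} (hjk : j < k)
    (hij : (i, j) ∈ minSupport (I : Set (ut n F)))
    (hkl : (k, l) ∈ minSupport (I : Set (ut n F))) {x : ut n F} (hx : x ∈ I) :
    x.1 i j • utE F (i, k) - x.1 k l • utE F (j, l) ∈ I.toSubmodule := by
  have hlam := minSupport_nonnesting (I : Set (ut n F))
  have hQ : ∀ f ∈ upSet (minSupport (I : Set (ut n F))) 2, utE F f ∈ I.toSubmodule :=
    fun f hf => utE_mem_of_mem_upSet_two I hf
  have hx0 := subset_utSupp_minSupport (I : Set (ut n F)) hx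
  have h1 := hlam.colShift_sub_mem hQ hx0 hjk hij
  have h2 := hlam.rowShift_sub_mem hQ hx0 hjk hkl
  have h3 := lieIdeal_lie_mem_right I hx (utE F (j, k))
  rw [lie_utE x hjk] at h3
  convert add_mem (sub_mem h2 h1) h3 using 1
  abel

/-- If the row term of the bracket with `e_{j,k}` lies in `I`, so does the column term. This and its
row analogue are the two halves of (S2), in contrapositive form. -/
lemma utE_mem_of_col {i j k : Fin n} (hjk : j < k)
    (hij : (i, j) ∈ minSupport (I : Set (ut n F)))
    (h : ∀ l, (k, l) ∈ minSupport (I : Set (ut n F)) → utE F (j, l) ∈ I) :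
    utE F (i, k) ∈ I := by
  have hlam := minSupport_nonnesting (I : Set (ut n F))
  have hQ : ∀ f ∈ upSet (minSupport (I : Set (ut n F))) 2, utE F f ∈ I.toSubmodule :=
    fun f hf => utE_mem_of_mem_upSet_two I hf
  obtain ⟨x, hx, hne⟩ := hij.1
  have hx0 := subset_utSupp_minSupport (I : Set (ut n F)) hx
  have h1 := hlam.colShift_sub_mem hQ hx0 hjk hij
  have h2 := hlam.rowShift_mem hQ hx0 hjk h
  have h3 := lieIdeal_lie_mem_right I hx (utE F (j, k))
  rw [lie_utE x hjk] at h3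
  have h4 := add_mem (sub_mem h2 h1) h3
  have h5 : x.1 i j • utE F (i, k) ∈ I.toSubmodule := by
    convert h4 using 1
    abel
  exact (Submodule.smul_mem_iff _ hne).mp h5

lemma utE_mem_of_row {j k l : Fin n} (hjk : j < k)
    (hkl : (k, l) ∈ minSupport (I : Set (ut n F)))
    (h : ∀ i, (i, j) ∈ minSupport (I : Set (ut n F)) → utE F (i, k) ∈ I) :
    utE F (j, l) ∈ I := by
  have hlam := minSupport_nonnesting (I : Set (ut n F))
  have hQ : ∀ f ∈ upSet (minSupport (I : Set (ut n F))) 2, utE F f ∈ I.toSubmodule :=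
    fun f hf => utE_mem_of_mem_upSet_two I hf
  obtain ⟨x, hx, hne⟩ := hkl.1
  have hx0 := subset_utSupp_minSupport (I : Set (ut n F)) hx
  have h1 := hlam.rowShift_sub_mem hQ hx0 hjk hkl
  have h2 := hlam.colShift_mem hQ hx0 hjk h
  have h3 := lieIdeal_lie_mem_right I hx (utE F (j, k))
  rw [lie_utE x hjk] at h3
  have h4 := sub_mem (sub_mem h2 h1) h3
  have h5 : x.1 k l • utE F (j, l) ∈ I.toSubmodule := by
    convert h4 using 1
    abel
  exact (Submodule.smul_mem_iff _ hne).mp h5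

/-- The vertical edges attached to a Lie ideal. -/
def idealNu : Set (Fin n × Fin n) :=
  {e | e ∈ upSet (minSupport (I : Set (ut n F))) 0 ∧ e ∉ minSupport (I : Set (ut n F)) ∧
    utE F e ∉ I}

lemma notMem_upSet_two_of_mem_idealNu {e : Fin n × Fin n} (he : e ∈ idealNu I) :
    e ∉ upSet (minSupport (I : Set (ut n F))) 2 :=
  fun h => he.2.2 (utE_mem_of_mem_upSet_two I h)

/-- These edges have excess height at least one, so an edge strictly above another would be in
`upSet (minSupport I) 2`, where all matrix units belong to `I`. -/
lemma idealNu_antichain : IsAntichain leE (idealNu I) := by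
  intro e he f hf hne hle
  have hlam := minSupport_nonnesting (I : Set (ut n F))
  apply notMem_upSet_two_of_mem_idealNu I hf
  refine upSet_add (hlam.mem_upSet_one he.1 he.2.1) (m := 1) hle.1 hle.2 ?_
  have h1 : f.1 ≤ e.1 ∧ e.2 ≤ f.2 := hle
  have h2 : e.1 < e.2 := he.1.1
  by_contra hc
  refine hne (Prod.ext (Fin.ext ?_) (Fin.ext ?_)) <;> omega

/-- The tight splice attached to a Lie ideal. -/
def idealSplice : TightSplice n where
  lam := minSupport (I : Set (ut n F))
  nu := idealNu I
  lam_nonnesting := minSupport_nonnesting _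
  nu_setPartition :=
    { increasing := fun _ he => he.1.1
      antichainL := fun _ he _ hf hne h => idealNu_antichain I he hf hne ⟨h.1, h.2.le⟩
      antichainR := fun _ he _ hf hne h => idealNu_antichain I he hf hne ⟨h.1.ge, h.2⟩ }
  disjoint := Set.disjoint_left.mpr fun _ he he' => he'.2.1 he
  splice_one i k he := by
    have hlam := minSupport_nonnesting (I : Set (ut n F))
    rcases hlam.exists_cover he.1 he.2.1 (notMem_upSet_two_of_mem_idealNu I he) with
      ⟨j, hj, hjk⟩ | ⟨j, hj, hjk⟩
    · exact ⟨j, hlam.lt hj, by rw [Fin.lt_def]; omega, Or.inl hj⟩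
    · exact ⟨j, by rw [Fin.lt_def]; omega, hlam.lt hj, Or.inr hj⟩
  splice_two j k hjk := by
    have hlam := minSupport_nonnesting (I : Set (ut n F))
    constructor
    · rintro ⟨i, hik, hij⟩
      by_contra hno
      refine hik.2.2 (utE_mem_of_col I hjk hij fun l hl => ?_)
      by_contra hl'
      have h1 := hlam.row_mem_upSet_one hjk hl
      exact hno ⟨l, hl, upSet_anti zero_le_one h1, fun h => hlam.notMem_upSet h one_pos h1, hl'⟩
    · rintro ⟨l, hkl, hjl⟩
      by_contra hno
      refine hjl.2.2 (utE_mem_of_row I hjk hkl fun i hi => ?_)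
      by_contra hi'
      have h1 := hlam.col_mem_upSet_one hjk hi
      exact hno ⟨i, ⟨upSet_anti zero_le_one h1, fun h => hlam.notMem_upSet h one_pos h1, hi'⟩, hi⟩
  tight := by
    have hlam := minSupport_nonnesting (I : Set (ut n F))
    ext e
    simp only [Set.mem_inter_iff, Set.mem_empty_iff_false, iff_false, not_and]
    rintro (he | he)
    · exact hlam.notMem_upSet he two_pos
    · exact notMem_upSet_two_of_mem_idealNu I he

/-- Each `x` in `I` puts `x_{ij} e_{ik} - x_{kl} e_{jl}` in `I`. Eliminating `e_{ik}` between two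
such elements leaves a multiple of `e_{jl}`, which is not in `I`; the multiple is zero, so the ratio
`x_{kl} / x_{ij}` does not depend on `x`. It is nonzero because `e_{ik}` is not in `I` either. -/
lemma exists_sig (b : (idealSplice I).bind) :
    ∃ s : Fˣ, (∀ x ∈ I, utEntry F ((idealSplice I).colTgt b) x =
      (s : F) * utEntry F ((idealSplice I).colSrc b) x) ∧
      utE F ((idealSplice I).rowSrc b) - (s : F) • utE F ((idealSplice I).rowTgt b) ∈
        I.toSubmodule := by
  obtain ⟨⟨i, j, k, l⟩, hij, hkl, hik, hjl, hjk⟩ := b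
  simp only at hij hkl hik hjl hjk
  obtain ⟨x, hx, hne⟩ := hij.1
  simp only at hne
  have h1 := smul_sub_smul_mem I hjk hij hkl hx
  have hne' : x.1 k l ≠ 0 := by
    intro h0
    rw [h0, zero_smul, sub_zero, Submodule.smul_mem_iff _ hne] at h1
    exact hik.2.2 h1
  refine ⟨Units.mk0 (x.1 k l / x.1 i j) (div_ne_zero hne' hne), fun y hy => ?_, ?_⟩
  · change y.1 k l = x.1 k l / x.1 i j * y.1 i j
    have h2 := smul_sub_smul_mem I hjk hij hkl hy
    have h3 := sub_mem (I.toSubmodule.smul_mem (x.1 i j) h2) (I.toSubmodule.smul_mem (y.1 i j) h1)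
    have h4 : (y.1 i j * x.1 k l - x.1 i j * y.1 k l) • utE F (j, l) ∈ I.toSubmodule := by
      convert h3 using 1
      module
    by_contra hc
    refine hjl.2.2 ((Submodule.smul_mem_iff _ ?_).mp h4)
    intro h5
    apply hc
    field_simp
    linear_combination -h5
  · have h2 := I.toSubmodule.smul_mem (x.1 i j)⁻¹ h1
    convert h2 using 1
    rw [smul_sub, smul_smul, smul_smul, inv_mul_cancel₀ hne, one_smul, ← div_eq_inv_mul]
    rfl

end IdealSplice

/-- The labeled matroid without edges. -/
def LabeledMatroid.edgeless (K : Type) [LinearOrder K] (F : Type*) [Field F] :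
    LabeledMatroid K F where
  U := Set.univ
  V := ∅
  isCompl := isCompl_top_bot
  E := ∅
  unidirectional := Set.empty_subset _
  covered := by simp
  increasing := by simp
  label := fun e => e.2.elim

/-! ### Every ideal comes from a datum -/

namespace IdealDatum

variable {n : ℕ} {ord : ∀ S : TightSplice n, LinearOrder S.CR} {F : Type*} [Field F]

/-- Every subspace between `D` and the hull which is nonzero at all horizontal edges, and contains
no matrix unit of a vertical edge, is obtained by replacing the matroid. -/
lemma exists_matroid (t : IdealDatum ord F) {W : Submodule F (ut n F)} (hD : t.D ≤ W)
    (hH : W ≤ t.hull) (hlam : ∀ e ∈ t.S.lam, ∃ x ∈ W, utEntry F e x ≠ 0)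
    (hnu : ∀ e ∈ t.S.nu, utE F e ∉ W) :
    ∃ M : @LabeledMatroid t.S.CR (ord t.S) F _, (⟨t.S, t.sig, M⟩ : IdealDatum ord F).toSubspace = W := by
  let := ord t.S
  have hfin : Fintype t.S.CR := Fintype.ofFinite _
  have h1 : ∀ u : t.S.CR, u.isLeft = true → ∃ f ∈ W.comap t.comb, f u ≠ 0 := by
    rintro (C | R) hu
    · obtain ⟨e, he⟩ := TightSplice.nonempty_of_mem_cols C.2
      have hel := TightSplice.subset_lam_of_mem_cols C.2 he
      obtain ⟨x, hx, hne⟩ := hlam e hel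
      obtain ⟨_, ⟨f, rfl⟩, d, hd, rfl⟩ := Submodule.mem_sup.mp (t.hull_le (hH hx))
      refine ⟨f, ?_, fun h0 => hne ?_⟩
      · have := sub_mem hx (hD hd)
        rwa [add_sub_cancel_right] at this
      · rw [map_add, t.utEntry_comb he, h0, zero_mul, zero_add]
        exact t.D_le_utSupp hd e fun h => h.2 hel
    · simp at hu
  obtain ⟨M, hM⟩ := LabeledMatroid.exists_rowSpace_eq (fun u : t.S.CR => u.isLeft = true)
    (W.comap t.comb) h1 (by
      rintro (C | R) hu
      · simp at hu
      · obtain ⟨e, he, h⟩ := exists_bRow_eq (F := F) R.2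
        intro hc
        rw [Submodule.mem_comap, t.comb_single] at hc
        change bRow R.1 ∈ _ at hc
        rw [h] at hc
        exact hnu e (TightSplice.subset_nu_of_mem_rows R.2 he) hc)
  refine ⟨M, ?_⟩
  rw [toSubspace_eq]
  change (M.rowSpace fun u => u.isLeft = true).map t.comb ⊔ t.D = _
  rw [hM, Submodule.map_comap_eq]
  refine le_antisymm (sup_le inf_le_right hD) fun x hx => ?_
  obtain ⟨y, hy, d, hd, rfl⟩ := Submodule.mem_sup.mp (t.hull_le (hH hx))
  have hyW : y ∈ W := by
    have := sub_mem hx (hD hd)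
    rwa [add_sub_cancel_right] at this
  exact add_mem (Submodule.mem_sup_left ⟨hy, hyW⟩) (Submodule.mem_sup_right hd)

lemma exists_toSubspace_eq (I : LieIdeal F (ut n F)) :
    ∃ t : IdealDatum ord F, t.toSubspace = I.toSubmodule := by
  choose sig hsig1 hsig2 using exists_sig I
  let t : IdealDatum ord F :=
    ⟨idealSplice I, sig, @LabeledMatroid.edgeless _ (ord (idealSplice I)) F _⟩
  have hD : t.D ≤ I.toSubmodule := by
    rw [D_le_iff]
    refine ⟨fun e he h1 h2 => ?_, hsig2⟩
    by_contra h3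
    exact h2 ⟨he, h1, h3⟩
  have hH : I.toSubmodule ≤ t.hull := fun x hx =>
    ⟨subset_utSupp_minSupport (I : Set (ut n F)) hx, fun b => hsig1 b x hx⟩
  obtain ⟨M, hM⟩ := t.exists_matroid hD hH (fun e he => he.1) (fun e he => he.2.2)
  exact ⟨_, hM⟩

/-- Data are in bijection with Lie ideals. -/
lemma toIdeal_bijective :
    Function.Bijective (toIdeal : IdealDatum ord F → LieIdeal F (ut n F)) := by
  constructor
  · intro t t' h
    exact toSubspace_injective (congrArg LieSubmodule.toSubmodule h)
  · intro I
    obtain ⟨t, ht⟩ := exists_toSubspace_eq (ord := ord) I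
    exact ⟨t, LieSubmodule.toSubmodule_injective ht⟩

end IdealDatum

/-! ### Lie ideals and normal subgroups -/

section Groups

variable {n : ℕ} {F : Type*} [Field F]

/-- The unitriangular matrix `1 + x`. -/
def utToUT (x : ut n F) : UT n F :=
  ⟨Matrix.GeneralLinearGroup.mk'' (1 + x.1) (by
    have h : (1 + x.1).BlockTriangular id := by
      intro i j hij
      have hij' : j < i := hij
      simp [Matrix.one_apply_ne hij'.ne', ut_apply_eq_zero x hij'.le]
    rw [Matrix.det_of_isUpperTriangular h]
    simp [ut_apply_eq_zero x le_rfl]), by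
    refine ⟨fun i j hij => ?_, fun i => ?_⟩
    · change (1 + x.1) i j = 0
      simp [Matrix.one_apply_ne hij.ne', ut_apply_eq_zero x hij.le]
    · change (1 + x.1) i i = 1
      simp [ut_apply_eq_zero x le_rfl]⟩

lemma coe_utToUT (x : ut n F) :
    ((utToUT x : GL (Fin n) F) : Matrix (Fin n) (Fin n) F) = 1 + x.1 := rfl

lemma UT_ext {g h : UT n F} (e : ((g : GL (Fin n) F) : Matrix (Fin n) (Fin n) F) =
    ((h : GL (Fin n) F) : Matrix (Fin n) (Fin n) F)) : g = h :=
  Subtype.ext (Units.ext e)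

/-- The strictly upper triangular matrix `g - 1`. -/
def utOfUT (g : UT n F) : ut n F :=
  ⟨((g : GL (Fin n) F) : Matrix (Fin n) (Fin n) F) - 1, fun i j hij => by
    rw [Matrix.sub_apply]
    rcases eq_or_lt_of_le hij with rfl | h
    · rw [g.2.2, Matrix.one_apply_eq, sub_self]
    · rw [g.2.1 i j h, Matrix.one_apply_ne h.ne', sub_zero]⟩

lemma coe_eq_one_add (g : UT n F) :
    ((g : GL (Fin n) F) : Matrix (Fin n) (Fin n) F) = 1 + (utOfUT g).1 :=
  (add_sub_cancel _ _).symm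

@[simp] lemma utToUT_utOfUT (g : UT n F) : utToUT (utOfUT g) = g :=
  UT_ext (by rw [coe_utToUT, ← coe_eq_one_add])

@[simp] lemma utOfUT_utToUT (x : ut n F) : utOfUT (utToUT x) = x :=
  Subtype.ext (add_sub_cancel_left _ _)

lemma mem_onePlus_iff {I : LieIdeal F (ut n F)} {g : UT n F} : g ∈ onePlus I ↔ utOfUT g ∈ I := by
  constructor
  · rintro ⟨a, ha, h⟩
    have : utOfUT g = a := by
      rw [coe_eq_one_add, add_right_inj] at h
      exact Subtype.ext h
    rwa [this]
  · exact fun h => ⟨_, h, coe_eq_one_add g⟩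

lemma utToUT_mul (x y : ut n F) : utToUT x * utToUT y = utToUT (x + y + utMul x y) := by
  apply UT_ext
  change (1 + x.1) * (1 + y.1) = 1 + (x.1 + y.1 + x.1 * y.1)
  noncomm_ring

lemma utToUT_zero : utToUT (0 : ut n F) = 1 := by
  apply UT_ext
  change 1 + (0 : Matrix (Fin n) (Fin n) F) = 1
  rw [add_zero]

lemma utOfUT_mul (g h : UT n F) :
    utOfUT (g * h) = utOfUT g + utOfUT h + utMul (utOfUT g) (utOfUT h) := by
  conv_lhs => rw [← utToUT_utOfUT g, ← utToUT_utOfUT h]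
  rw [utToUT_mul, utOfUT_utToUT]

lemma utOfUT_one : utOfUT (1 : UT n F) = 0 := by rw [← utToUT_zero, utOfUT_utToUT]

lemma one_add_mul_inv (g : UT n F) : (1 + (utOfUT g).1) * (1 + (utOfUT g⁻¹).1) = 1 := by
  rw [← coe_eq_one_add, ← coe_eq_one_add, ← Units.val_mul, ← Subgroup.coe_mul, mul_inv_cancel]
  rfl

lemma utOfUT_conj (g h : UT n F) : utOfUT (g * h * g⁻¹) =
    utOfUT h - (⁅utOfUT h, utOfUT g⁆ + utMul ⁅utOfUT h, utOfUT g⁆ (utOfUT g⁻¹)) := by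
  apply Subtype.ext
  have h1 : (utOfUT (g * h * g⁻¹)).1 = ((g : GL (Fin n) F) : Matrix (Fin n) (Fin n) F) *
      ((h : GL (Fin n) F) : Matrix (Fin n) (Fin n) F) *
      ((g⁻¹ : UT n F) : GL (Fin n) F) - 1 := rfl
  rw [h1, coe_eq_one_add g, coe_eq_one_add h, coe_eq_one_add g⁻¹]
  change _ = (utOfUT h).1 - ((⁅utOfUT h, utOfUT g⁆ : ut n F).1 +
    (⁅utOfUT h, utOfUT g⁆ : ut n F).1 * (utOfUT g⁻¹).1)
  rw [ut_coe_lie]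
  have h2 := one_add_mul_inv g
  generalize (utOfUT g).1 = a at *
  generalize (utOfUT h).1 = x at *
  generalize (utOfUT g⁻¹).1 = b at *
  have h3 : (1 + a) * (1 + x) * (1 + b) =
      (1 + a) * (1 + b) + x * ((1 + a) * (1 + b)) - ((x * a - a * x) + (x * a - a * x) * b) := by
    noncomm_ring
  rw [h3, h2, mul_one]
  abel

lemma utOfUT_commutator (g h : UT n F) : utOfUT (g * h * g⁻¹ * h⁻¹) =
    ⁅utOfUT g, utOfUT h⁆ + utMul ⁅utOfUT g, utOfUT h⁆ (utOfUT (h * g)⁻¹) := by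
  apply Subtype.ext
  have h0 : g * h * g⁻¹ * h⁻¹ = g * h * (h * g)⁻¹ := by group
  rw [h0]
  have h1 : (utOfUT (g * h * (h * g)⁻¹)).1 = ((g : GL (Fin n) F) : Matrix (Fin n) (Fin n) F) *
      ((h : GL (Fin n) F) : Matrix (Fin n) (Fin n) F) *
      (((h * g)⁻¹ : UT n F) : GL (Fin n) F) - 1 := rfl
  have h2 := one_add_mul_inv (h * g)
  rw [← coe_eq_one_add (h * g)] at h2
  have h3 : (((h * g : UT n F) : GL (Fin n) F) : Matrix (Fin n) (Fin n) F) =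
      (1 + (utOfUT h).1) * (1 + (utOfUT g).1) := by
    rw [← coe_eq_one_add, ← coe_eq_one_add]; rfl
  rw [h3] at h2
  rw [h1, coe_eq_one_add g, coe_eq_one_add h, coe_eq_one_add (h * g)⁻¹]
  change _ = (⁅utOfUT g, utOfUT h⁆ : ut n F).1 +
    (⁅utOfUT g, utOfUT h⁆ : ut n F).1 * (utOfUT (h * g)⁻¹).1
  rw [ut_coe_lie]
  generalize (utOfUT g).1 = x at *
  generalize (utOfUT h).1 = a at *
  generalize (utOfUT (h * g)⁻¹).1 = b at *
  have h4 : (1 + x) * (1 + a) * (1 + b) =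
      (1 + a) * (1 + x) * (1 + b) + ((x * a - a * x) + (x * a - a * x) * b) := by
    noncomm_ring
  rw [h4, h2]
  abel

lemma lieIdeal_prodSet_mem (I : LieIdeal F (ut n F)) {m : ut n F}
    (hm : m ∈ utSupp F (prodSet (minSupport (I : Set (ut n F))) 0)) : m ∈ I :=
  (isCommClosed_lieIdeal I).utSupp_prodSet_subset n 0 (by omega) hm

/-- The normal subgroup `1 + I`. -/
def onePlusSubgroup [Finite F] (I : LieIdeal F (ut n F)) : Subgroup (UT n F) :=
  let S : Submonoid (UT n F) :=
    { carrier := {g | utOfUT g ∈ I}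
      one_mem' := by
        change utOfUT 1 ∈ I
        rw [utOfUT_one]; exact zero_mem I
      mul_mem' := by
        intro g h hg hh
        change utOfUT (g * h) ∈ I
        rw [utOfUT_mul]
        exact add_mem (add_mem hg hh) (lieIdeal_prodSet_mem I
          (utMul_mem_prodSet (X := (I : Set (ut n F))) hg hh)) }
  { S with
    inv_mem' := by
      intro g hg
      -- The group is finite, so closure under inverses follows from closure under products.
      have h1 : g⁻¹ = g ^ (orderOf g - 1) := by
        rw [inv_eq_iff_mul_eq_one, ← pow_succ', Nat.sub_add_cancel (orderOf_pos g),
          pow_orderOf_eq_one]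
      rw [h1]
      exact S.pow_mem hg _ }

lemma mem_onePlusSubgroup [Finite F] {I : LieIdeal F (ut n F)} {g : UT n F} :
    g ∈ onePlusSubgroup I ↔ utOfUT g ∈ I := Iff.rfl

lemma coe_onePlusSubgroup [Finite F] (I : LieIdeal F (ut n F)) :
    (onePlusSubgroup I : Set (UT n F)) = onePlus I := by
  ext g
  rw [mem_onePlus_iff]
  rfl

lemma onePlusSubgroup_normal [Finite F] (I : LieIdeal F (ut n F)) :
    (onePlusSubgroup I).Normal where
  conj_mem h hh g := by
    rw [mem_onePlusSubgroup] at *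
    rw [utOfUT_conj]
    exact sub_mem hh (add_mem (lieIdeal_lie_mem_right I hh _) (lieIdeal_prodSet_mem I
      (utMul_lie_mem_prodSet (X := (I : Set (ut n F))) hh _ _)))

lemma onePlus_injective : Function.Injective (onePlus : LieIdeal F (ut n F) → Set (UT n F)) := by
  intro I J h
  ext x
  rw [← utOfUT_utToUT x, ← mem_onePlus_iff, ← mem_onePlus_iff, h]

lemma exists_equiv_closedNormalSubgroups [Finite F] :
    ∃ Ψ : LieIdeal F (ut n F) ≃ closedNormalSubgroups n F,
      ∀ I, ((Ψ I : Subgroup (UT n F)) : Set (UT n F)) = onePlus I := by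
  let f : LieIdeal F (ut n F) → closedNormalSubgroups n F := fun I =>
    ⟨onePlusSubgroup I, onePlusSubgroup_normal I, I, coe_onePlusSubgroup I⟩
  refine ⟨Equiv.ofBijective f ⟨fun I J h => ?_, ?_⟩, fun I => coe_onePlusSubgroup I⟩
  · apply onePlus_injective
    rw [← coe_onePlusSubgroup, ← coe_onePlusSubgroup]
    exact congrArg (fun N : closedNormalSubgroups n F => ((N : Subgroup (UT n F)) : Set (UT n F))) h
  · rintro ⟨N, hN, I, hI⟩
    refine ⟨I, Subtype.ext (SetLike.coe_injective ?_)⟩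
    rw [hI]
    exact coe_onePlusSubgroup I

/-- A subset of a vector space over a prime field which is closed under addition and negation is
closed under scalar multiplication. -/
lemma smul_mem_of_prime_card {V : Type*} [AddCommGroup V] [Module F V] (hF : (Nat.card F).Prime)
    {T : Set V} {x : V} (h0 : (0 : V) ∈ T)
    (hadd : ∀ c d : F, c • x ∈ T → d • x ∈ T → (c + d) • x ∈ T)
    (hneg : ∀ c : F, c • x ∈ T → (-c) • x ∈ T) {c : F} (hc : c ≠ 0) (hcx : c • x ∈ T) (d : F) :
    d • x ∈ T := by
  -- The admissible scalars form an additive subgroup of a group of prime order, hence are only zero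
  -- or everything.
  let A : AddSubgroup F :=
    { carrier := {c | c • x ∈ T}
      zero_mem' := by simpa using h0
      add_mem' := fun {c d} hc hd => hadd c d hc hd
      neg_mem' := fun {c} hc => hneg c hc }
  have : Fact (Nat.card F).Prime := ⟨hF⟩
  rcases A.eq_bot_or_eq_top_of_prime_card with h | h
  · have h1 : c ∈ A := hcx
    rw [h, AddSubgroup.mem_bot] at h1
    exact absurd h1 hc
  · have h1 : d ∈ A := h ▸ AddSubgroup.mem_top d
    exact h1

/-! ### Normal subgroups over a prime field -/

variable {N : Subgroup (UT n F)}

lemma isCommClosed_of_normal (hF : (Nat.card F).Prime) (hN : N.Normal) :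
    IsCommClosed {x : ut n F | utToUT x ∈ N} where
  zero_mem := by
    change utToUT 0 ∈ N
    rw [utToUT_zero]; exact one_mem N
  lie_mem x hx a := by
    refine ⟨utOfUT (utToUT a * utToUT x)⁻¹, ?_⟩
    have h := utOfUT_commutator (utToUT x) (utToUT a)
    rw [utOfUT_utToUT, utOfUT_utToUT] at h
    rw [← h]
    change utToUT (utOfUT _) ∈ N
    rw [utToUT_utOfUT, mul_assoc, mul_assoc]
    refine N.mul_mem hx ?_
    rw [← mul_assoc]
    exact hN.conj_mem _ (N.inv_mem hx) _
  add_mem A hA hAX x hx m hm := by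
    let b := utOfUT (utToUT x)⁻¹
    have hb : (1 + x.1) * (1 + b.1) = 1 := by
      have := one_add_mul_inv (utToUT x)
      rwa [utOfUT_utToUT] at this
    have hbm : m + utMul b m ∈ utSupp F A := by
      refine add_mem hm (mem_utSupp_of fun r s hrs => ?_)
      obtain ⟨t, h1, h2⟩ := exists_of_utMul_ne_zero hrs
      exact hA (t, s) (mem_of_mem_utSupp hm (e := (t, s)) h2) _ ⟨(lt_of_ut_ne_zero h1).le, le_rfl⟩
    -- Factor `1 + x + m` as `(1 + x)(1 + (1 + x)⁻¹ m)`. Left multiplication only moves entries of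
    -- `m` upwards, so the second factor still has support in `A`.
    have h1 : utToUT (x + m) = utToUT x * utToUT (m + utMul b m) := by
      apply UT_ext
      change 1 + (x.1 + m.1) = (1 + x.1) * (1 + (m.1 + b.1 * m.1))
      have h2 : (1 + x.1) * (1 + (m.1 + b.1 * m.1)) = 1 + x.1 + (1 + x.1) * (1 + b.1) * m.1 := by
        noncomm_ring
      rw [h2, hb, one_mul, add_assoc]
    change utToUT (x + m) ∈ N
    rw [h1]
    exact N.mul_mem hx (hAX hbm)
  smul_mem w c hc hcw d := by
    -- A strictly upper matrix unit squares to zero, so `c ↦ 1 + c e_w` is a homomorphism from the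
    -- additive group of `F`.
    have hz : ∀ c d : F, utMul (c • utE F w) (d • utE F w) = 0 := by
      intro c d
      refine ut_ext fun i j _ => ?_
      by_contra h0
      obtain ⟨k, h1, h2⟩ := exists_of_utMul_ne_zero h0
      have h3 : (utE F w).1 i k ≠ 0 := right_ne_zero_of_mul h1
      have h4 : (utE F w).1 k j ≠ 0 := right_ne_zero_of_mul h2
      have h5 := lt_of_ut_ne_zero h3
      rw [utE_apply] at h3 h4
      simp only [ne_eq, ite_eq_right_iff, Classical.not_imp] at h3 h4
      have h6 : i = k := (congrArg Prod.fst h3.1.2).trans (congrArg Prod.fst h4.1.2).symm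
      exact h5.ne h6
    have hmul : ∀ c d : F, utToUT ((c + d) • utE F w) =
        utToUT (c • utE F w) * utToUT (d • utE F w) := by
      intro c d
      rw [utToUT_mul, hz, add_zero, add_smul]
    refine smul_mem_of_prime_card hF ?_ (fun c d hc hd => ?_) (fun c hc => ?_) hc hcw d
    · change utToUT 0 ∈ N
      rw [utToUT_zero]; exact one_mem N
    · change utToUT _ ∈ N
      rw [hmul]; exact N.mul_mem hc hd
    · have h1 : utToUT ((-c) • utE F w) = (utToUT (c • utE F w))⁻¹ := by
        rw [eq_inv_iff_mul_eq_one, ← hmul, neg_add_cancel, zero_smul, utToUT_zero]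
      change utToUT _ ∈ N
      rw [h1]; exact N.inv_mem hc

/-- The Lie ideal `N - 1` of a normal subgroup `N` of a unitriangular group over a prime field. -/
def idealOfNormal (hF : (Nat.card F).Prime) (hN : N.Normal) : LieIdeal F (ut n F) :=
  have hX := isCommClosed_of_normal hF hN
  have hadd : ∀ x y : ut n F, utToUT x ∈ N → utToUT y ∈ N → utToUT (x + y) ∈ N := by
    intro x y hx hy
    have h1 : utToUT (x + y + utMul x y) ∈ N := by
      rw [← utToUT_mul]; exact N.mul_mem hx hy
    have h2 := hX.add_mem_of_mem_prodSet h1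
      (neg_mem (utMul_mem_prodSet (X := {x : ut n F | utToUT x ∈ N}) hx hy))
    rwa [add_neg_cancel_right] at h2
  have hneg : ∀ x : ut n F, utToUT x ∈ N → utToUT (-x) ∈ N := by
    intro x hx
    have hy : utToUT (utOfUT (utToUT x)⁻¹) ∈ N := by
      rw [utToUT_utOfUT]; exact N.inv_mem hx
    -- With `1 + y` the inverse of `1 + x`, this reads `0 = x + y + xy`, so `-x = y + xy`, and `xy`
    -- is absorbed.
    have h1 := utOfUT_mul (utToUT x) (utToUT x)⁻¹
    rw [mul_inv_cancel, utOfUT_one, utOfUT_utToUT] at h1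
    have h2 := hX.add_mem_of_mem_prodSet hy
      (utMul_mem_prodSet (X := {x : ut n F | utToUT x ∈ N}) hx hy)
    rw [add_assoc] at h1
    rw [← eq_neg_of_add_eq_zero_right h1.symm]
    exact h2
  { carrier := {x | utToUT x ∈ N}
    zero_mem' := hX.zero_mem
    add_mem' := fun {x y} hx hy => hadd x y hx hy
    smul_mem' := fun c x hx => smul_mem_of_prime_card (T := {x : ut n F | utToUT x ∈ N}) hF
      hX.zero_mem (fun c d hc hd => by rw [add_smul]; exact hadd _ _ hc hd)
      (fun c hc => by rw [neg_smul]; exact hneg _ hc) one_ne_zero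
      (by rw [one_smul]; exact hx) c
    lie_mem := fun {a x} hx => by
      obtain ⟨v, hv⟩ := hX.lie_mem x hx a
      have h1 := hX.add_mem_of_mem_prodSet hv
        (neg_mem (utMul_lie_mem_prodSet (X := {x : ut n F | utToUT x ∈ N}) hx a v))
      rw [add_neg_cancel_right] at h1
      rw [← lie_skew]
      exact hneg _ h1 }

lemma onePlus_idealOfNormal (hF : (Nat.card F).Prime) (hN : N.Normal) :
    onePlus (idealOfNormal hF hN) = (N : Set (UT n F)) := by
  ext g
  rw [mem_onePlus_iff]
  change utToUT (utOfUT g) ∈ N ↔ g ∈ N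
  rw [utToUT_utOfUT]

lemma closedNormalSubgroups_eq (hF : (Nat.card F).Prime) :
    closedNormalSubgroups n F = {N : Subgroup (UT n F) | N.Normal} := by
  ext N
  exact ⟨fun h => h.1, fun h => ⟨h, idealOfNormal hF h, (onePlus_idealOfNormal hF h).symm⟩⟩

end Groups

end

theorem theoremB (n : ℕ) (F : Type*) [Field F] [Finite F]
    (ord : ∀ S : TightSplice n, LinearOrder S.CR) :
    (∃ Φ : IdealDatum ord F ≃ LieIdeal F (ut n F),
      ∀ t, (Φ t).toSubmodule = t.toSubspace) ∧
    (∃ Ψ : LieIdeal F (ut n F) ≃ closedNormalSubgroups n F,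
      ∀ I, ((Ψ I : Subgroup (UT n F)) : Set (UT n F)) = onePlus I) ∧
    ((Nat.card F).Prime → closedNormalSubgroups n F = {N : Subgroup (UT n F) | N.Normal}) :=
  ⟨⟨Equiv.ofBijective _ IdealDatum.toIdeal_bijective, fun _ => rfl⟩,
    exists_equiv_closedNormalSubgroups, closedNormalSubgroups_eq⟩
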